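/- Let $p$ be a prime, $\kappa$ a perfect field of characteristic $p$, and $\mathbb{F}$ a one-dimensional commutative formal group (law) over $\kappa$ of finite height $n$. Put $\mathbb{L}=\mathbb{Z}_p^n$ and let $\mathbb{T}=\mathbb{L}^*\cong(\mathbb{Q}_p/\mathbb{Z}_p)^n$ be its Pontryagin dual. Let $\mathrm{Sub}(\mathbb{T})$ be the set of finite subgroups of $\mathbb{T}$ and $\mathrm{Isog}(\mathbb{T})$ the monoid of endomorphisms of $\mathbb{T}$ with finite kernel. A section is a map $\phi\colon \mathrm{Sub}(\mathbb{T})\to\mathrm{Isog}(\mathbb{T})$, $H\mapsto\phi_H$, with $\ker\phi_H=H$ for all $H$. For a finite subgroup $A\subset\mathbb{T}$ and a complete local ring $(R,\mathfrak{m})$, let $\mathrm{Level}(A)(R)$ be the set of triples $(l\colon A\to\mathbb{G},i,\tau)$ up to $\star$-isomorphism, where $\mathbb{G}$ is a formal group over $R$, $i\colon\kappa\to R/\mathfrak{m}$ is a ring map, $\tau\colon\mathbb{G}\otimes_R R/\mathfrak{m}\cong i^*\mathbb{F}$ is an isomorphism, and $l$ is a level structure (a homomorphism $A\to\mathbb{G}(R)$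 whose divisor $\sum_{a\in A}[l(a)]$ is a subgroup scheme of $\mathbb{G}$); a $\star$-isomorphism is an isomorphism of formal groups over $R$ that is compatible with $i$, $\tau$ and $l$. Let $\mathcal{O}_{\mathrm{Level}(A)}$ be the representing ring (Drinfeld), and let $C_0=\mathbb{Q}\otimes\operatorname{colim}_{A}\mathcal{O}_{\mathrm{Level}(A)}$, the colimit over the finite subgroups of $\mathbb{T}$ (equivalently over the $\mathbb{T}[p^k]$), along restriction of level structures. The monoid $\mathrm{Isog}(\mathbb{T})$ acts on $C_0$ from the right by ring maps: $\varphi\in\mathrm{Isog}(\mathbb{T})$ with kernel $H$ of order $p^k$ is induced by $(l,i,\tau)\mapsto(l',\,i\circ\sigma^k,\,\tau/H)$ from $\mathrm{Level}(\varphi^{-1}A)$ to $\mathrm{Level}(A)$. Here $q\colon\mathbb{G}\to\mathbb{G}/l(H)$ is the quotient, $l'\colon A\to\mathbb{G}/l(H)$ is determined by $l'\circ\varphi=q\circ l$, $\sigma$ is the Frobenius of $\kappa$, and $\tau/H$ is determined by $(\tau/H)\circ \bar q=\mathrm{Frob}^k\circ\tau$, where $\bar q$ is the reduction of $q$ modulo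 $\mathfrak{m}$. For a finite group $G$ let $\mathrm{Cl}_n(G,C_0)$ be the ring of functions $\hom(\mathbb{L},G)/\!\sim\;\to C_0$ on conjugacy classes of continuous homomorphisms. The group $\mathrm{Aut}(\mathbb{T})$ (anti-isomorphic to $\mathrm{GL}_n(\mathbb{Z}_p)$ by duality) acts on it by $(f\cdot\gamma)([\alpha])=f([\alpha\gamma^*])\,\gamma$, where $\gamma^*\colon\mathbb{L}\to\mathbb{L}$ is the Pontryagin dual of $\gamma$. Given $m\ge 0$ and a section $\phi$, define $$P_m^{\phi}\colon\mathrm{Cl}_n(G,C_0)\to\mathrm{Cl}_n(G\times\Sigma_m,C_0),\qquad P_m^{\phi}(f)([(\alpha,\beta)])=\prod_{o} f([\alpha\phi_{H_o}^*])\,\phi_{H_o},$$ where $o$ runs over the orbits of $\mathbb{L}$ on $\{1,\dots,m\}$ through $\beta\colon\mathbb{L}\to\Sigma_m$, and $H_o=(\mathbb{L}/\mathbb{L}_o)^*\subset\mathbb{T}$ with $\mathbb{L}_o$ the stabilizer of a point of $o$. Then, for every section $\phi$, $P_m^{\phi}$ sends $\mathrm{Aut}(\mathbb{T})$-invariant functions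 to $\mathrm{Aut}(\mathbb{T})$-invariant functions, and the resulting map $$\mathrm{Cl}_n(G,C_0)^{\mathrm{Aut}(\mathbb{T})}\to\mathrm{Cl}_n(G\times\Sigma_m,C_0)^{\mathrm{Aut}(\mathbb{T})}$$ does not depend on $\phi$. -/

import Mathlib

noncomputable section
namespace LubinTate
open MvPowerSeries MvPowerSeries.WithPiTopology Filter Topology
set_option linter.unusedSectionVars false

section Eval
variable {R : Type*} [CommRing R] [UniformSpace R] [IsUniformAddGroup R] [IsTopologicalRing R]
variable {B : Type*} [CommRing B] [UniformSpace B] [IsUniformAddGroup B] [CompleteSpace B]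
  [T2Space B] [IsTopologicalRing B] [IsLinearTopology B B] [Algebra R B] [ContinuousSMul R B]
variable {σ τ : Type*}

/-- Evaluation of a power series over `R` at a tuple of elements of a topological `R`-algebra. -/
def ev (a : σ → B) (f : MvPowerSeries σ R) : B := MvPowerSeries.eval₂ (algebraMap R B) a f

theorem ev_eq_aeval {a : σ → B} (ha : HasEval a) (f : MvPowerSeries σ R) :
    ev a f = aeval ha f := by rw [coe_aeval]; rfl

theorem ev_sub {a : σ → B} (ha : HasEval a) (f g : MvPowerSeries σ R) :
    ev a (f - g) = ev a f - ev a g := by simp only [ev_eq_aeval ha, map_sub]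

theorem ev_add {a : σ → B} (ha : HasEval a) (f g : MvPowerSeries σ R) :
    ev a (f + g) = ev a f + ev a g := by simp only [ev_eq_aeval ha, map_add]

theorem ev_mul {a : σ → B} (ha : HasEval a) (f g : MvPowerSeries σ R) :
    ev a (f * g) = ev a f * ev a g := by simp only [ev_eq_aeval ha, map_mul]

theorem ev_zero {a : σ → B} (ha : HasEval a) : ev a (0 : MvPowerSeries σ R) = 0 := by
  simp only [ev_eq_aeval ha, map_zero]

theorem hasSum_ev {a : σ → B} (ha : HasEval a) (f : MvPowerSeries σ R) :
    HasSum (fun d : σ →₀ ℕ => coeff d f • d.prod fun s e => a s ^ e) (ev a f) := by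
  rw [ev_eq_aeval ha]; exact hasSum_aeval ha f

theorem hasEval_of_finite [Finite σ] {a : σ → B} (h : ∀ s, IsTopologicallyNilpotent (a s)) :
    HasEval a := ⟨h, by simp [cofinite_eq_bot]⟩

theorem subst_eq_ev [CompleteSpace R] [T2Space R] [IsLinearTopology R R]
    {a : σ → MvPowerSeries τ R} (ha : HasSubst a) (f : MvPowerSeries σ R) :
    subst a f = ev a f := by
  have h1 := hasSum_ev (R := R) ha.hasEval f
  have h2 : HasSum (fun d : σ →₀ ℕ => coeff d f • d.prod fun s e => a s ^ e) (subst a f) := by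
    rw [hasSum_iff_hasSum_coeff]
    intro d
    rw [coeff_subst ha]
    have hf := coeff_subst_finite ha f d
    rw [finsum_eq_sum _ hf]
    exact hasSum_sum_of_ne_finset_zero (f := fun x : σ →₀ ℕ =>
      coeff d (coeff x f • x.prod fun s e => a s ^ e)) (L := SummationFilter.unconditional _) (by
        intro b hb; simpa using hb)
  exact h2.unique h1

theorem ev_comp [CompleteSpace R] [T2Space R] [IsLinearTopology R R]
    {C : Type*} [CommRing C] [UniformSpace C] [IsUniformAddGroup C] [CompleteSpace C]
    [T2Space C] [IsTopologicalRing C] [IsLinearTopology C C] [Algebra R C] [ContinuousSMul R C]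
    {a : σ → B} (ha : HasEval a) (ε : B →ₐ[R] C) (hε : Continuous ε) (f : MvPowerSeries σ R) :
    ε (ev a f) = ev (fun s => ε (a s)) f := by
  have h2 : HasEval (fun s => ε (a s)) := ha.map (φ := (ε : B →+* C)) hε
  rw [ev_eq_aeval ha, ev_eq_aeval h2]
  exact DFunLike.congr_fun (comp_aeval ha hε) f

theorem ev_ev [CompleteSpace R] [T2Space R] [IsLinearTopology R R]
    {a : σ → MvPowerSeries τ R} (ha : HasEval a) {b : τ → B} (hb : HasEval b) (f : MvPowerSeries σ R) :
    ev b (ev a f) = ev (fun s => ev b (a s)) f := by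
  have := ev_comp ha (aeval (R := R) hb) (continuous_aeval hb) f
  simpa only [← ev_eq_aeval hb] using this

theorem ev_subst [CompleteSpace R] [T2Space R] [IsLinearTopology R R]
    {a : σ → MvPowerSeries τ R} (ha : HasSubst a) {b : τ → B} (hb : HasEval b)
    (f : MvPowerSeries σ R) :
    ev b (subst a f) = ev (fun s => ev b (a s)) f := by
  rw [subst_eq_ev ha, ev_ev ha.hasEval hb]

theorem ev_nilp [Finite σ] {a : σ → B} (ha : ∀ s, IsTopologicallyNilpotent (a s))
    {f : MvPowerSeries σ R} (hf : constantCoeff f = 0) : IsTopologicallyNilpotent (ev a f) := by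
  classical
  have hs := hasSum_ev (R := R) (hasEval_of_finite ha) f
  have hN : ∀ s : Finset (σ →₀ ℕ), IsTopologicallyNilpotent
      (∑ d ∈ s, coeff d f • d.prod fun s e => a s ^ e) := by
    intro s
    refine (PowerSeries.mem_hasEvalIdeal_iff).1 (Ideal.sum_mem _ fun d _ => ?_)
    by_cases hd : d = 0
    · subst hd
      have : coeff (0 : σ →₀ ℕ) f = 0 := by simpa using hf
      simp [this]
    · obtain ⟨i, hi⟩ : d.support.Nonempty := d.support_nonempty_iff.mpr hd
      rw [Algebra.smul_def, Finsupp.prod, ← Finset.mul_prod_erase _ _ hi]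
      refine Ideal.mul_mem_left _ _ (Ideal.mul_mem_right _ _ ?_)
      exact Ideal.pow_mem_of_mem _ ((PowerSeries.mem_hasEvalIdeal_iff).2 (ha i)) _
        (Nat.pos_of_ne_zero (Finsupp.mem_support_iff.1 hi))
  rw [IsTopologicallyNilpotent, IsLinearTopology.hasBasis_ideal.tendsto_right_iff]
  intro I hI
  have h1 := hs.sub_const (ev a f)
  have h2 : ∀ᶠ s in atTop (α := Finset (σ →₀ ℕ)),
      (∑ d ∈ s, coeff d f • d.prod fun s e => a s ^ e) - ev a f ∈ I := by
    have : Tendsto (fun s : Finset (σ →₀ ℕ) =>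
      (∑ d ∈ s, coeff d f • d.prod fun s e => a s ^ e) - ev a f) atTop (𝓝 0) := by
      have := (show Tendsto _ _ _ from hs).sub_const (ev a f)
      simpa using this
    exact this.eventually_mem hI
  obtain ⟨s, hs⟩ := h2.exists
  have h3 := hN s
  rw [IsTopologicallyNilpotent, IsLinearTopology.hasBasis_ideal.tendsto_right_iff] at h3
  filter_upwards [h3 I hI] with n hn
  simp only [SetLike.mem_coe, ← Ideal.Quotient.eq_zero_iff_mem, map_pow] at hn ⊢
  rwa [← (Ideal.Quotient.eq.2 hs)]

end Eval

section FAdd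
variable {R : Type*} [CommRing R] [UniformSpace R] [IsUniformAddGroup R] [IsTopologicalRing R]
  [CompleteSpace R] [T2Space R] [IsLinearTopology R R]
variable {B : Type*} [CommRing B] [UniformSpace B] [IsUniformAddGroup B] [CompleteSpace B]
  [T2Space B] [IsTopologicalRing B] [IsLinearTopology B B] [Algebra R B] [ContinuousSMul R B]
variable {σ τ : Type*}

/-- The formal sum `a +_G b`. -/
def fadd (G : FormalGroup R) (a b : B) : B := ev ![a, b] G.toPowerSeries

theorem hasEval_pair {a b : B} (ha : IsTopologicallyNilpotent a) (hb : IsTopologicallyNilpotent b) :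
    HasEval ![a, b] := hasEval_of_finite (by intro s; fin_cases s <;> assumption)

variable (G : FormalGroup R)

theorem fadd_nilp {a b : B} (ha : IsTopologicallyNilpotent a) (hb : IsTopologicallyNilpotent b) :
    IsTopologicallyNilpotent (fadd G a b) :=
  ev_nilp (by intro s; fin_cases s <;> assumption) G.zero_constantCoeff

theorem map_fadd {C : Type*} [CommRing C] [UniformSpace C] [IsUniformAddGroup C] [CompleteSpace C]
    [T2Space C] [IsTopologicalRing C] [IsLinearTopology C C] [Algebra R C] [ContinuousSMul R C]
    {a b : B} (ha : IsTopologicallyNilpotent a) (hb : IsTopologicallyNilpotent b)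
    (ε : B →ₐ[R] C) (hε : Continuous ε) : ε (fadd G a b) = fadd G (ε a) (ε b) := by
  rw [fadd, ev_comp (hasEval_pair ha hb) ε hε, fadd]
  congr 1; ext s; fin_cases s <;> rfl

theorem ev_fadd {a : τ → B} (ha : HasEval a) {u v : MvPowerSeries τ R}
    (hu : IsTopologicallyNilpotent u) (hv : IsTopologicallyNilpotent v) :
    ev a (fadd G u v) = fadd G (ev a u) (ev a v) := by
  have := map_fadd G hu hv (aeval (R := R) ha) (continuous_aeval ha)
  simpa only [← ev_eq_aeval ha] using this

theorem ev_X {a : τ → B} (i : τ) : ev a (X i : MvPowerSeries τ R) = a i := by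
  simp [ev]

theorem ev_C {a : τ → B} (r : R) : ev a (C r : MvPowerSeries τ R) = algebraMap R B r := by
  simp [ev]

theorem fadd_eq_subst {u v : MvPowerSeries τ R} (hu : PowerSeries.HasSubst u) (hv : PowerSeries.HasSubst v) :
    fadd G u v = G.toPowerSeries.subst ![u, v] :=
  (subst_eq_ev (hasSubst_of_constantCoeff_nilpotent (by intro s; fin_cases s <;> assumption)) _).symm

theorem X_nilp (i : τ) : IsTopologicallyNilpotent (X i : MvPowerSeries τ R) :=
  HasEval.X.hpow i

theorem fadd_assoc {a b c : B} (ha : IsTopologicallyNilpotent a) (hb : IsTopologicallyNilpotent b)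
    (hc : IsTopologicallyNilpotent c) : fadd G (fadd G a b) c = fadd G a (fadd G b c) := by
  have h : HasEval ![a, b, c] := hasEval_of_finite (by intro s; fin_cases s <;> assumption)
  have key := congrArg (ev ![a, b, c]) (G.assoc' (σ := Fin 3) (f₀ := X 0) (f₁ := X 1) (f₂ := X 2)
    (PowerSeries.HasSubst.X 0) (PowerSeries.HasSubst.X 1) (PowerSeries.HasSubst.X 2))
  rw [← fadd_eq_subst G (PowerSeries.HasSubst.X 0) (PowerSeries.HasSubst.X 1),
    ← fadd_eq_subst G (PowerSeries.HasSubst.X 1) (PowerSeries.HasSubst.X 2)] at key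
  have n1 : PowerSeries.HasSubst (fadd G (X 0) (X 1) : MvPowerSeries (Fin 3) R) := by
    rw [fadd_eq_subst G (PowerSeries.HasSubst.X 0) (PowerSeries.HasSubst.X 1)]
    apply PowerSeries.HasSubst.of_constantCoeff_zero
    exact constantCoeff_subst_eq_zero HasSubst.X_X (by intro i; fin_cases i <;> simp) G.zero_constantCoeff
  have n2 : PowerSeries.HasSubst (fadd G (X 1) (X 2) : MvPowerSeries (Fin 3) R) := by
    rw [fadd_eq_subst G (PowerSeries.HasSubst.X 1) (PowerSeries.HasSubst.X 2)]
    apply PowerSeries.HasSubst.of_constantCoeff_zero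
    exact constantCoeff_subst_eq_zero HasSubst.X_X (by intro i; fin_cases i <;> simp) G.zero_constantCoeff
  rw [← fadd_eq_subst G n1 (PowerSeries.HasSubst.X 2), ← fadd_eq_subst G (PowerSeries.HasSubst.X 0) n2,
    ev_fadd G h (fadd_nilp G (X_nilp _) (X_nilp _)) (X_nilp _), ev_fadd G h (X_nilp _) (fadd_nilp G (X_nilp _) (X_nilp _)),
    ev_fadd G h (X_nilp _) (X_nilp _), ev_fadd G h (X_nilp _) (X_nilp _)] at key
  simpa [ev_X] using key

theorem fadd_comm [G.IsComm] {a b : B} (ha : IsTopologicallyNilpotent a)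
    (hb : IsTopologicallyNilpotent b) : fadd G a b = fadd G b a := by
  have h : HasEval ![a, b] := hasEval_pair ha hb
  have key := congrArg (ev ![a, b]) (G.comm' (σ := Fin 2) (f := X 0) (g := X 1)
    (PowerSeries.HasSubst.X 0) (PowerSeries.HasSubst.X 1))
  rw [← fadd_eq_subst G (PowerSeries.HasSubst.X 0) (PowerSeries.HasSubst.X 1),
    ← fadd_eq_subst G (PowerSeries.HasSubst.X 1) (PowerSeries.HasSubst.X 0),
    ev_fadd G h (X_nilp _) (X_nilp _), ev_fadd G h (X_nilp _) (X_nilp _)] at key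
  simpa [ev_X] using key

theorem nilp_zero : IsTopologicallyNilpotent (0 : B) := PowerSeries.HasEval.zero

theorem fadd_zero {a : B} (ha : IsTopologicallyNilpotent a) : fadd G a 0 = a := by
  have h : HasEval (fun _ : Unit => a) := hasEval_of_finite (fun _ => ha)
  have key := congrArg (ev (fun _ : Unit => a)) (G.add_zero (σ := Unit) (PowerSeries.HasSubst.X ()))
  rw [← fadd_eq_subst G (PowerSeries.HasSubst.X ()) PowerSeries.HasSubst.zero,
    ev_fadd G h (X_nilp _) nilp_zero, ev_X] at key
  have h0 : ev (fun _ : Unit => a) (0 : MvPowerSeries Unit R) = 0 := by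
    rw [ev_eq_aeval h, map_zero]
  rwa [h0] at key

theorem zero_fadd {a : B} (ha : IsTopologicallyNilpotent a) : fadd G 0 a = a := by
  have h : HasEval (fun _ : Unit => a) := hasEval_of_finite (fun _ => ha)
  have key := congrArg (ev (fun _ : Unit => a)) (G.zero_add (σ := Unit) (PowerSeries.HasSubst.X ()))
  rw [← fadd_eq_subst G PowerSeries.HasSubst.zero (PowerSeries.HasSubst.X ()),
    ev_fadd G h nilp_zero (X_nilp _), ev_X] at key
  have h0 : ev (fun _ : Unit => a) (0 : MvPowerSeries Unit R) = 0 := by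
    rw [ev_eq_aeval h, map_zero]
  rwa [h0] at key

end FAdd

section Translate
variable {R : Type*} [CommRing R] [UniformSpace R] [IsUniformAddGroup R] [IsTopologicalRing R]
  [CompleteSpace R] [T2Space R] [IsLinearTopology R R]
variable {τ : Type*} [Finite τ] [DecidableEq τ]

theorem C_nilp {r : R} (hr : IsTopologicallyNilpotent r) :
    IsTopologicallyNilpotent (C r : MvPowerSeries τ R) :=
  LinearTopology.isTopologicallyNilpotent_of_constantCoeff (by simpa using hr)

/-- Replace the variable `X i` by `b`. -/
def upd (i : τ) (b : MvPowerSeries τ R) : τ → MvPowerSeries τ R := Function.update X i b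

theorem upd_same (i : τ) (b : MvPowerSeries τ R) : upd i b i = b := by simp [upd]

theorem upd_ne {i j : τ} (h : j ≠ i) (b : MvPowerSeries τ R) : upd i b j = X j := by simp [upd, h]

theorem upd_hasEval (i : τ) {b : MvPowerSeries τ R} (hb : IsTopologicallyNilpotent b) :
    HasEval (upd i b) := hasEval_of_finite fun j => by
  by_cases h : j = i
  · subst h; rwa [upd_same]
  · rw [upd_ne h]; exact X_nilp j

theorem ev_X_self (s : MvPowerSeries τ R) : ev (X : τ → MvPowerSeries τ R) s = s := by
  rw [← subst_eq_ev HasSubst.X, subst_self]; rfl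

theorem ev_upd_upd (i : τ) {b c : MvPowerSeries τ R} (hb : IsTopologicallyNilpotent b)
    (hc : IsTopologicallyNilpotent c) (s : MvPowerSeries τ R) :
    ev (upd i c) (ev (upd i b) s) = ev (upd i (ev (upd i c) b)) s := by
  rw [ev_ev (upd_hasEval i hb) (upd_hasEval i hc)]
  congr 1; ext1 j
  by_cases h : j = i
  · subst h; simp only [upd_same]
  · rw [upd_ne h, ev_X, upd_ne h, upd_ne h]

theorem X_dvd_sub_ev_zero (i : τ) (t : MvPowerSeries τ R) :
    (X i : MvPowerSeries τ R) ∣ t - ev (upd i 0) t := by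
  have hs : HasSubst (upd i (0 : MvPowerSeries τ R)) := by
    refine hasSubst_of_constantCoeff_zero fun j => ?_
    by_cases h : j = i
    · subst h; simp [upd_same]
    · simp [upd_ne h]
  rw [X_dvd_iff]
  intro m hm
  rw [← subst_eq_ev hs, map_sub, coeff_subst hs, finsum_eq_single _ m]
  · have : (m.prod fun s e => upd i (0 : MvPowerSeries τ R) s ^ e) = monomial m 1 := by
      rw [monomial_eq', map_one, one_mul]
      refine Finsupp.prod_congr fun j hj => ?_
      rw [upd_ne]; rintro rfl; simp [hm] at hj
    rw [this]; simp
  · intro d hd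
    by_cases hdi : d i = 0
    · have : (d.prod fun s e => upd i (0 : MvPowerSeries τ R) s ^ e) = monomial d 1 := by
        rw [monomial_eq', map_one, one_mul]
        refine Finsupp.prod_congr fun j hj => ?_
        rw [upd_ne]; rintro rfl; simp [hdi] at hj
      rw [this, coeff_monomial_ne hd.symm, smul_zero]
    · have : (d.prod fun s e => upd i (0 : MvPowerSeries τ R) s ^ e) = 0 := by
        rw [Finsupp.prod]
        refine Finset.prod_eq_zero (i := i) (by simp [hdi]) ?_
        rw [upd_same, zero_pow hdi]
      rw [this]; simp

theorem dvd_sub_ev (i : τ) {h : R} (hh : IsTopologicallyNilpotent h) (s : MvPowerSeries τ R) :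
    (X i - C h : MvPowerSeries τ R) ∣ s - ev (upd i (C h)) s := by
  have n1 : IsTopologicallyNilpotent (X i + C h : MvPowerSeries τ R) :=
    LinearTopology.isTopologicallyNilpotent_of_constantCoeff (by simpa using hh)
  have hh' : IsTopologicallyNilpotent (-h) := by
    have := (PowerSeries.hasEvalIdeal (S := R)).neg_mem ((PowerSeries.mem_hasEvalIdeal_iff).2 hh)
    exact (PowerSeries.mem_hasEvalIdeal_iff).1 this
  have n2 : IsTopologicallyNilpotent (X i - C h : MvPowerSeries τ R) :=
    LinearTopology.isTopologicallyNilpotent_of_constantCoeff (by simpa using hh')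
  obtain ⟨u, hu⟩ := X_dvd_sub_ev_zero i (ev (upd i (X i + C h)) s)
  have e0 : ∀ r : R, ∀ b : MvPowerSeries τ R, ev (upd i b) (C r : MvPowerSeries τ R) = C r :=
    fun r b => ev_C r
  have key := congrArg (aeval (R := R) (upd_hasEval i n2)) hu
  simp only [map_sub, map_mul] at key
  simp only [← ev_eq_aeval] at key
  have add_ev : ∀ {b : MvPowerSeries τ R} (hb : IsTopologicallyNilpotent b),
      ev (upd i b) (X i + C h : MvPowerSeries τ R) = b + C h := by
    intro b hb
    rw [ev_eq_aeval (upd_hasEval i hb), map_add, ← ev_eq_aeval, ← ev_eq_aeval, e0, ev_X, upd_same]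
  have z0 : ev (upd i (X i - C h)) (0 : MvPowerSeries τ R) = 0 := by
    rw [ev_eq_aeval (upd_hasEval i n2), map_zero]
  rw [ev_upd_upd i n1 n2, add_ev n2, sub_add_cancel, ev_upd_upd i n1 nilp_zero, add_ev nilp_zero,
    zero_add, ev_upd_upd i (C_nilp hh) n2, e0, ev_X, upd_same] at key
  have hx : upd i (X i : MvPowerSeries τ R) = X := by simp [upd]
  rw [hx, ev_X_self] at key
  exact ⟨_, key⟩

theorem prod_dvd_of_roots [IsDomain R] (i : τ) {ι : Type*} (h : ι → R) (hinj : Function.Injective h)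
    (hh : ∀ a, IsTopologicallyNilpotent (h a)) (S : Finset ι) :
    ∀ s : MvPowerSeries τ R, (∀ a ∈ S, ev (upd i (C (h a))) s = 0) →
      (∏ a ∈ S, (X i - C (h a) : MvPowerSeries τ R)) ∣ s := by
  classical
  induction S using Finset.induction_on with
  | empty => intro s _; simp
  | insert a S ha ih =>
    intro s hs
    have h1 := dvd_sub_ev i (hh a) s
    rw [hs a (Finset.mem_insert_self _ _), sub_zero] at h1
    obtain ⟨t, rfl⟩ := h1
    rw [Finset.prod_insert ha]
    refine mul_dvd_mul_left _ (ih t fun b hb => ?_)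
    have h2 := hs b (Finset.mem_insert_of_mem hb)
    have hE := upd_hasEval (R := R) i (C_nilp (τ := τ) (hh b))
    rw [ev_eq_aeval hE, map_mul, map_sub, ← ev_eq_aeval, ← ev_eq_aeval, ← ev_eq_aeval, ev_X,
      upd_same, ev_C, ← c_eq_algebraMap] at h2
    rcases mul_eq_zero.1 h2 with h3 | h3
    · exfalso
      rw [sub_eq_zero] at h3
      have : h b = h a := by
        have := congrArg constantCoeff h3
        simpa using this
      exact ha (hinj this ▸ hb)
    · exact h3

end Translate

section Lubin
variable {R : Type*} [CommRing R] [UniformSpace R] [IsUniformAddGroup R] [IsTopologicalRing R]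
  [CompleteSpace R] [T2Space R] [IsLinearTopology R R]
variable {B : Type*} [CommRing B] [UniformSpace B] [IsUniformAddGroup B] [CompleteSpace B]
  [T2Space B] [IsTopologicalRing B] [IsLinearTopology B B] [Algebra R B] [ContinuousSMul R B]
variable {H : Type*} [CommGroup H] [Fintype H]

/-- `h : H → R` is a homomorphism from `H` to the group of points of `G`. -/
structure IsPts (G : FormalGroup R) (h : H → R) : Prop where
  nilp : ∀ a, IsTopologicallyNilpotent (h a)
  one : h 1 = 0
  mul : ∀ a b, h (a * b) = fadd G (h a) (h b)

/-- Lubin's norm `∏_{a ∈ H} (b +_G h a)`. -/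
def nrm (G : FormalGroup R) (h : H → R) (b : B) : B := ∏ a, fadd G b (algebraMap R B (h a))

variable {G : FormalGroup R} {h : H → R}

theorem algebraMap_nilp {r : R} (hr : IsTopologicallyNilpotent r) :
    IsTopologicallyNilpotent (algebraMap R B r) :=
  hr.map (continuous_algebraMap R B)

theorem algebraMap_fadd {a b : R} (ha : IsTopologicallyNilpotent a)
    (hb : IsTopologicallyNilpotent b) :
    algebraMap R B (fadd G a b) = fadd G (algebraMap R B a) (algebraMap R B b) :=
  map_fadd G ha hb (Algebra.ofId R B) (continuous_algebraMap R B)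

theorem nrm_nilp (hh : IsPts G h) {b : B} (hb : IsTopologicallyNilpotent b) :
    IsTopologicallyNilpotent (nrm G h b) := by
  classical
  rw [nrm, ← Finset.mul_prod_erase _ _ (Finset.mem_univ (1 : H))]
  exact (fadd_nilp G hb (algebraMap_nilp (hh.nilp 1))).mul_right _

theorem nrm_zero (hh : IsPts G h) : nrm G h (0 : B) = 0 := by
  rw [nrm]
  exact Finset.prod_eq_zero (Finset.mem_univ (1 : H)) (by
    rw [hh.one, map_zero, fadd_zero G nilp_zero])

theorem map_nrm {C : Type*} [CommRing C] [UniformSpace C] [IsUniformAddGroup C] [CompleteSpace C]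
    [T2Space C] [IsTopologicalRing C] [IsLinearTopology C C] [Algebra R C] [ContinuousSMul R C]
    (hh : IsPts G h) {b : B} (hb : IsTopologicallyNilpotent b)
    (ε : B →ₐ[R] C) (hε : Continuous ε) : ε (nrm G h b) = nrm G h (ε b) := by
  rw [nrm, map_prod, nrm]
  refine Finset.prod_congr rfl fun a _ => ?_
  rw [map_fadd G hb (algebraMap_nilp (hh.nilp a)) ε hε, AlgHom.commutes]

theorem ev_nrm {τ : Type*} (hh : IsPts G h) {a : τ → B} (ha : HasEval a) {b : MvPowerSeries τ R}
    (hb : IsTopologicallyNilpotent b) : ev a (nrm G h b) = nrm G h (ev a b) := by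
  have := map_nrm hh hb (aeval (R := R) ha) (continuous_aeval ha)
  simpa only [← ev_eq_aeval ha] using this

theorem nrm_translate [G.IsComm] (hh : IsPts G h) {b : B} (hb : IsTopologicallyNilpotent b) (a : H) :
    nrm G h (fadd G b (algebraMap R B (h a))) = nrm G h b := by
  rw [nrm, nrm, ← Equiv.prod_comp (Equiv.mulLeft a) (fun c => fadd G b (algebraMap R B (h c)))]
  refine Finset.prod_congr rfl fun c _ => ?_
  rw [fadd_assoc G hb (algebraMap_nilp (hh.nilp a)) (algebraMap_nilp (hh.nilp c)),
    Equiv.coe_mulLeft, hh.mul, algebraMap_fadd (hh.nilp a) (hh.nilp c)]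

theorem isUnit_one_add {r : R} (hr : IsTopologicallyNilpotent r) : IsUnit (1 + r) := by
  have hr' : PowerSeries.HasEval (-r) :=
    (PowerSeries.mem_hasEvalIdeal_iff).1
      ((PowerSeries.hasEvalIdeal (S := R)).neg_mem ((PowerSeries.mem_hasEvalIdeal_iff).2 hr))
  have := congrArg (PowerSeries.aeval (R := R) hr') (PowerSeries.mk_one_mul_one_sub_eq_one R)
  rw [map_mul, map_sub, map_one] at this
  have hX : PowerSeries.aeval (R := R) hr' (PowerSeries.X : PowerSeries R) = -r := by
    rw [PowerSeries.coe_aeval]; simp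
  rw [hX, sub_neg_eq_add] at this
  exact IsUnit.of_mul_eq_one_right _ this

variable {τ : Type*} [Finite τ] [DecidableEq τ]

/-- `b +_G c = b + c u`. -/
theorem fadd_eq_add_mul (G : FormalGroup R) :
    ∃ u : MvPowerSeries (Fin 2) R, ∀ b c : MvPowerSeries τ R, IsTopologicallyNilpotent b →
      IsTopologicallyNilpotent c → fadd G b c = b + c * ev ![b, c] u := by
  obtain ⟨u, hu⟩ := X_dvd_sub_ev_zero (1 : Fin 2) G.toPowerSeries
  refine ⟨u, fun b c hb hc => ?_⟩
  have e1 : ev (upd (1 : Fin 2) 0) G.toPowerSeries = (X 0 : MvPowerSeries (Fin 2) R) := by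
    rw [← fadd_zero G (X_nilp (R := R) (0 : Fin 2)), fadd]
    congr 1; ext1 s; fin_cases s
    · exact upd_ne (by decide) _
    · exact upd_same _ _
  rw [e1] at hu
  have hE := hasEval_pair hb hc
  have := congrArg (aeval (R := R) hE) hu
  rw [map_sub, map_mul, ← ev_eq_aeval, ← ev_eq_aeval, ← ev_eq_aeval, ← ev_eq_aeval, ev_X, ev_X] at this
  simp only [Matrix.cons_val_zero, Matrix.cons_val_one] at this
  rw [fadd, ← this]; ring

theorem fadd_X_C (hh : IsPts G h) (i : τ) (a : H) :
    ∃ w : MvPowerSeries τ R, IsUnit w ∧ fadd G (X i) (C (h a)) = (X i - C (h a⁻¹)) * w := by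
  have n1 := X_nilp (R := R) i
  have n2 := C_nilp (τ := τ) (hh.nilp a)
  obtain ⟨w, hw⟩ := dvd_sub_ev i (hh.nilp a⁻¹) (fadd G (X i) (C (h a)))
  have e1 : ev (upd i (C (h a⁻¹))) (fadd G (X i) (C (h a)) : MvPowerSeries τ R) = 0 := by
    rw [ev_fadd G (upd_hasEval i (C_nilp (hh.nilp _))) n1 n2, ev_X, upd_same, ev_C,
      c_eq_algebraMap, ← algebraMap_fadd (hh.nilp _) (hh.nilp _), ← hh.mul]
    simp [hh.one]
  rw [e1, sub_zero] at hw
  refine ⟨w, ?_, hw⟩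
  obtain ⟨u, hu⟩ := fadd_eq_add_mul (τ := τ) G
  rw [hu _ _ n1 n2] at hw
  have h1 := congrArg (coeff (Finsupp.single i 1)) hw
  rw [map_add, coeff_C_mul, sub_mul, map_sub, coeff_C_mul] at h1
  have h2 : coeff (Finsupp.single i 1) (X i * w) = constantCoeff w := by
    have := coeff_add_monomial_mul (Finsupp.single i 1) 0 w (1 : R)
    simpa [X] using this
  rw [h2, coeff_index_single_self_X] at h1
  rw [isUnit_iff_constantCoeff]
  have h3 : constantCoeff w = 1 + (h a * coeff (Finsupp.single i 1) (ev ![X i, C (h a)] u)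
      + h a⁻¹ * coeff (Finsupp.single i 1) w) := by linear_combination -h1
  rw [h3]
  exact isUnit_one_add (((hh.nilp a).mul_right _).add ((hh.nilp _).mul_right _))

theorem nrm_X (hh : IsPts G h) (i : τ) :
    ∃ w : MvPowerSeries τ R, IsUnit w ∧ nrm G h (X i) = (∏ a, (X i - C (h a))) * w := by
  choose w hw e using fadd_X_C hh i
  refine ⟨∏ a, w a, ?_, ?_⟩
  · exact (Finset.univ.prod_induction _ IsUnit (fun _ _ => IsUnit.mul) isUnit_one fun a _ => hw a)
  · rw [nrm, ← Equiv.prod_comp (Equiv.inv H) (fun a => (X i - C (h a) : MvPowerSeries τ R)),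
      ← Finset.prod_mul_distrib]
    refine Finset.prod_congr rfl fun a _ => ?_
    rw [← c_eq_algebraMap, e]; rfl

/-- Invariance of a power series under translation of each variable by the points of `H`. -/
def Inv (G : FormalGroup R) (h : H → R) (s : MvPowerSeries τ R) : Prop :=
  ∀ i a, ev (upd i (fadd G (X i) (C (h a)))) s = s

variable [IsDomain R]

theorem nrm_X_ne_zero (hh : IsPts G h) (i : τ) : nrm G h (X i : MvPowerSeries τ R) ≠ 0 := by
  obtain ⟨w, hw, e⟩ := nrm_X hh i
  rw [e]
  refine mul_ne_zero (Finset.prod_ne_zero_iff.2 fun a _ h0 => ?_) hw.ne_zero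
  have := congrArg (coeff (Finsupp.single i 1)) h0
  rw [map_sub, coeff_index_single_self_X] at this
  rw [coeff_C, if_neg (by simp)] at this
  simp at this

theorem trans_nilp (hh : IsPts G h) (i : τ) (a : H) :
    IsTopologicallyNilpotent (fadd G (X i) (C (h a)) : MvPowerSeries τ R) :=
  fadd_nilp G (X_nilp i) (C_nilp (hh.nilp a))

theorem inv_ev_C (hh : IsPts G h) (i : τ) {s : MvPowerSeries τ R} (hs : Inv G h s) (a : H) :
    ev (upd i (C (h a))) s = ev (upd i (0 : MvPowerSeries τ R)) s := by
  have n0 : IsTopologicallyNilpotent (0 : MvPowerSeries τ R) := nilp_zero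
  have nt := trans_nilp (τ := τ) hh i a
  have nC := C_nilp (τ := τ) (hh.nilp a)
  have E0 := upd_hasEval i n0
  have := congrArg (ev (upd i (0 : MvPowerSeries τ R))) (hs i a)
  rw [ev_upd_upd i nt n0, ev_fadd G E0 (X_nilp i) nC,
      ev_X, upd_same, ev_C, ← c_eq_algebraMap, zero_fadd G nC] at this
  exact this

theorem inv_ev_zero (hh : IsPts G h) (i : τ) {s : MvPowerSeries τ R} (hs : Inv G h s) :
    Inv G h (ev (upd i (0 : MvPowerSeries τ R)) s) := by
  have n0 : IsTopologicallyNilpotent (0 : MvPowerSeries τ R) := nilp_zero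
  have E0 := upd_hasEval i n0
  intro j a
  have nt := trans_nilp (τ := τ) hh j a
  have nC := C_nilp (τ := τ) (hh.nilp a)
  have Ej := upd_hasEval j nt
  have z := ev_zero (R := R) Ej
  by_cases hj : j = i
  · subst hj
    rw [ev_upd_upd j n0 nt, z]
  · have := congrArg (ev (upd i (0 : MvPowerSeries τ R))) (hs j a)
    rw [ev_ev Ej E0] at this
    rw [ev_ev E0 Ej]
    refine Eq.trans ?_ this
    refine congrArg (fun f : τ → MvPowerSeries τ R => ev f s) (funext fun k => ?_)
    by_cases hk : k = i
    · subst hk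
      rw [upd_same, z, upd_ne (Ne.symm hj), ev_X, upd_same]
    · rw [upd_ne hk, ev_X]
      by_cases hkj : k = j
      · subst hkj
        rw [upd_same, ev_fadd G E0 (X_nilp k) nC, ev_X, upd_ne hk, ev_C, c_eq_algebraMap]
      · rw [upd_ne hkj, ev_X, upd_ne hk]

theorem nrm_dvd_inv (hh : IsPts G h) (hinj : Function.Injective h) (i : τ)
    {s : MvPowerSeries τ R} (hs : Inv G h s) :
    nrm G h (X i) ∣ s - ev (upd i (0 : MvPowerSeries τ R)) s := by
  have n0 : IsTopologicallyNilpotent (0 : MvPowerSeries τ R) := nilp_zero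
  obtain ⟨w, hw, e⟩ := nrm_X (τ := τ) hh i
  rw [e, hw.mul_right_dvd]
  refine prod_dvd_of_roots i h hinj hh.nilp _ _ fun a _ => ?_
  have nC := C_nilp (τ := τ) (hh.nilp a)
  have EC := upd_hasEval i nC
  rw [ev_sub EC, inv_ev_C hh i hs, ev_upd_upd i n0 nC, ev_zero EC, sub_self]

theorem ev_trans_nrm [G.IsComm] (hh : IsPts G h) (i j : τ) (a : H) :
    ev (upd j (fadd G (X j) (C (h a)))) (nrm G h (X i : MvPowerSeries τ R)) = nrm G h (X i) := by
  have Ej := upd_hasEval j (trans_nilp (τ := τ) hh j a)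
  rw [ev_nrm hh Ej (X_nilp i), ev_X]
  by_cases hj : i = j
  · subst hj
    have := nrm_translate (B := MvPowerSeries τ R) hh (X_nilp i) a
    rw [← c_eq_algebraMap] at this
    rw [upd_same, this]
  · rw [upd_ne hj]

theorem inv_step [G.IsComm] (hh : IsPts G h) (hinj : Function.Injective h) (i : τ)
    {s : MvPowerSeries τ R} (hs : Inv G h s) :
    ∃ s₁, Inv G h s₁ ∧ s = ev (upd i (0 : MvPowerSeries τ R)) s + nrm G h (X i) * s₁ := by
  obtain ⟨s₁, hs₁⟩ := nrm_dvd_inv hh hinj i hs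
  refine ⟨s₁, fun j a => ?_, by rw [← hs₁]; ring⟩
  have hE := upd_hasEval j (trans_nilp (τ := τ) hh j a)
  have h2 := congrArg (ev (upd j (fadd G (X j) (C (h a))))) hs₁
  rw [ev_sub hE, ev_mul hE, hs j a, inv_ev_zero hh i hs j a, ev_trans_nrm hh, hs₁] at h2
  exact (mul_left_cancel₀ (nrm_X_ne_zero hh i) h2).symm

end Lubin

section Descent
variable {R : Type*} [CommRing R] {τ : Type*}

/-- The tuple `(q(X i))_i`. -/
def sub1 (q : PowerSeries R) : τ → MvPowerSeries τ R := fun i => q.subst (X i : MvPowerSeries τ R)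

theorem sub1_const {q : PowerSeries R} (h0 : q.constantCoeff = 0) (i : τ) :
    (sub1 q i).constantCoeff = 0 :=
  PowerSeries.constantCoeff_subst_eq_zero (by simp) _ h0

variable [Finite τ]

theorem sub1_hasSubst {q : PowerSeries R} (h0 : q.constantCoeff = 0) :
    HasSubst (sub1 q : τ → MvPowerSeries τ R) :=
  hasSubst_of_constantCoeff_zero (sub1_const h0)

theorem subst_sub1_sub1 {p q : PowerSeries R} (hp : p.constantCoeff = 0)
    (hq : q.constantCoeff = 0) (h : p.subst q = PowerSeries.X) (s : MvPowerSeries τ R) :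
    subst (sub1 q) (subst (sub1 p) s) = s := by
  rw [subst_comp_subst_apply (sub1_hasSubst hp) (sub1_hasSubst hq)]
  have : (fun i => subst (sub1 q) (sub1 p i)) = (X : τ → MvPowerSeries τ R) := by
    funext i
    have hX := PowerSeries.HasSubst.X (S := R) i
    have hqq : PowerSeries.HasSubst q := PowerSeries.HasSubst.of_constantCoeff_zero' hq
    rw [sub1, PowerSeries.subst_def, subst_comp_subst_apply hX.const (sub1_hasSubst hq)]
    have h3 := congrArg (PowerSeries.subst (X i : MvPowerSeries τ R)) h
    rw [PowerSeries.subst_comp_subst_apply hqq hX, PowerSeries.subst_X hX] at h3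
    refine Eq.trans ?_ h3
    rw [PowerSeries.subst_def]
    congr 1; funext _
    rw [subst_X (sub1_hasSubst hq), sub1]
  rw [this, subst_self, id]

theorem sub1_map {S : Type*} [CommRing S] (f : R →+* S) (q : PowerSeries R) (i : τ) :
    (sub1 q i).map f = sub1 (PowerSeries.map f q) i :=
  by rw [sub1, PowerSeries.map_subst (PowerSeries.HasSubst.X i), map_X, sub1]

theorem map_sub1 {S : Type*} [CommRing S] (f : R →+* S) {q : PowerSeries R}
    (h0 : q.constantCoeff = 0) (s : MvPowerSeries τ R) :
    (subst (sub1 q) s).map f = subst (sub1 (PowerSeries.map f q)) (s.map f) := by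
  rw [map_subst (sub1_hasSubst h0)]
  congr 1; funext i; exact sub1_map f q i

theorem map_const {S : Type*} [CommRing S] (f : R →+* S) {q : PowerSeries R}
    (h0 : q.constantCoeff = 0) : (PowerSeries.map f q).constantCoeff = 0 := by
  rw [← PowerSeries.coeff_zero_eq_constantCoeff_apply, PowerSeries.coeff_map,
    PowerSeries.coeff_zero_eq_constantCoeff_apply, h0, map_zero]

variable [IsDomain R]

theorem exists_inv {q : PowerSeries R} (h0 : q.constantCoeff = 0) (h1 : q.coeff 1 ≠ 0) :
    ∃ p : PowerSeries (FractionRing R), p.constantCoeff = 0 ∧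
      p.subst (PowerSeries.map (algebraMap R (FractionRing R)) q) = PowerSeries.X ∧
      (PowerSeries.map (algebraMap R (FractionRing R)) q).subst p = PowerSeries.X := by
  have hu : IsUnit ((PowerSeries.map (algebraMap R (FractionRing R)) q).coeff 1) := by
    rw [PowerSeries.coeff_map]
    exact isUnit_iff_ne_zero.2 (by simpa using h1)
  have hc : (PowerSeries.map (algebraMap R (FractionRing R)) q).constantCoeff = 0 := map_const _ h0
  exact ⟨_, PowerSeries.constantCoeff_substInvOfIsUnit _ hu,
    PowerSeries.subst_substInvOfIsUnit_left _ hc hu, PowerSeries.subst_substInvOfIsUnit_right _ hc hu⟩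

theorem mv_map_injective : Function.Injective
    (MvPowerSeries.map (σ := τ) (algebraMap R (FractionRing R))) := by
  intro a b h
  ext d
  have := congrArg (coeff d) h
  simpa using this

theorem sub1_injective {q : PowerSeries R} (h0 : q.constantCoeff = 0) (h1 : q.coeff 1 ≠ 0) :
    Function.Injective (subst (sub1 q) : MvPowerSeries τ R → MvPowerSeries τ R) := by
  obtain ⟨p, hp, -, hpq⟩ := exists_inv h0 h1
  intro s t hst
  have := congrArg (MvPowerSeries.map (algebraMap R (FractionRing R))) hst
  rw [map_sub1 _ h0, map_sub1 _ h0] at this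
  have h2 := congrArg (subst (sub1 p)) this
  have hc : (PowerSeries.map (algebraMap R (FractionRing R)) q).constantCoeff = 0 := map_const _ h0
  rw [subst_sub1_sub1 hc hp hpq, subst_sub1_sub1 hc hp hpq] at h2
  exact mv_map_injective h2

theorem sub1_surj [Fintype τ] {q : PowerSeries R} (h0 : q.constantCoeff = 0) (h1 : q.coeff 1 ≠ 0)
    (P : MvPowerSeries τ R → Prop)
    (hP : ∀ s, P s → ∃ t : τ → MvPowerSeries τ R, (∀ i, P (t i)) ∧
      s = C (constantCoeff s) + ∑ i, sub1 q i * t i) (s : MvPowerSeries τ R) (hs : P s) :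
    ∃ g : MvPowerSeries τ R, subst (sub1 q) g = s := by
  classical
  obtain ⟨p, hp, hpq, hqp⟩ := exists_inv h0 h1
  let f := algebraMap R (FractionRing R)
  have hc : (PowerSeries.map f q).constantCoeff = 0 := map_const _ h0
  have hS := sub1_hasSubst (τ := τ) hp
  have key : ∀ N : ℕ, ∀ d : τ →₀ ℕ, d.degree = N → ∀ s, P s →
      ∃ r, f r = coeff d (subst (sub1 p) (s.map f)) := by
    intro N
    induction N with
    | zero =>
      intro d hd s _
      rw [Finsupp.degree_eq_zero_iff] at hd
      subst hd
      refine ⟨constantCoeff s, ?_⟩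
      have h2 : constantCoeff (subst (sub1 p) (s.map f - C (f (constantCoeff s)))) = 0 :=
        constantCoeff_subst_eq_zero hS (sub1_const hp) (by simp)
      rw [subst_sub hS, map_sub, subst_C, constantCoeff_C, sub_eq_zero] at h2
      exact h2.symm
    | succ N ih =>
      intro d hd s hs
      obtain ⟨t, ht, e⟩ := hP s hs
      have hd0 : d ≠ 0 := by rintro rfl; simp at hd
      have e2 : subst (sub1 p) (s.map f) = C (f (constantCoeff s)) +
          ∑ i, X i * subst (sub1 p) ((t i).map f) := by
        conv_lhs => rw [e]
        rw [map_add, map_C, map_sum, ← substAlgHom_apply (R := FractionRing R) hS, map_add, map_sum]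
        congr 1
        · rw [substAlgHom_apply hS, subst_C]
        · refine Finset.sum_congr rfl fun i _ => ?_
          rw [map_mul, map_mul, sub1_map, substAlgHom_apply hS, substAlgHom_apply hS]
          congr 1
          have := subst_sub1_sub1 (τ := τ) hc hp hqp (X i)
          rwa [subst_X (sub1_hasSubst hc)] at this
      rw [e2, map_add, coeff_C, if_neg hd0, zero_add, map_sum]
      have h3 : ∀ i, ∃ r, f r = coeff d (X i * subst (sub1 p) ((t i).map f)) := by
        intro i
        rw [X, coeff_monomial_mul, one_mul]
        split_ifs with hi
        · refine ih _ ?_ _ (ht i)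
          have := congrArg Finsupp.degree (tsub_add_cancel_of_le hi)
          rw [map_add, hd, Finsupp.degree_single] at this
          omega
        · exact ⟨0, map_zero _⟩
      choose r hr using h3
      exact ⟨∑ i, r i, by rw [map_sum]; simp only [hr]⟩
  choose r hr using fun d => key _ d rfl s hs
  obtain ⟨g, hg⟩ : ∃ g : MvPowerSeries τ R, g.map f = subst (sub1 p) (s.map f) := by
    refine ⟨(show MvPowerSeries τ R from r), MvPowerSeries.ext fun d => ?_⟩
    rw [← hr d]; rfl
  refine ⟨g, mv_map_injective ?_⟩
  rw [map_sub1 _ h0, hg, subst_sub1_sub1 hp hc hpq]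

end Descent

section Lubin2
variable {R : Type*} [CommRing R] [UniformSpace R] [IsUniformAddGroup R] [IsTopologicalRing R]
  [CompleteSpace R] [T2Space R] [IsLinearTopology R R]
variable {B : Type*} [CommRing B] [UniformSpace B] [IsUniformAddGroup B] [CompleteSpace B]
  [T2Space B] [IsTopologicalRing B] [IsLinearTopology B B] [Algebra R B] [ContinuousSMul R B]
variable {H : Type*} [CommGroup H] [Fintype H]
variable {G : FormalGroup R} {h : H → R}
variable {τ : Type*} [Fintype τ] [DecidableEq τ]

/-- The power series `∏_{a ∈ H} (X +_G h a)`. -/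
def qs (G : FormalGroup R) (h : H → R) : PowerSeries R := nrm G h (X () : MvPowerSeries Unit R)

theorem ev_qs (hh : IsPts G h) {b : B} (hb : IsTopologicallyNilpotent b) :
    ev (fun _ : Unit => b) (qs G h) = nrm G h b := by
  rw [qs, ev_nrm hh (hasEval_of_finite fun _ => hb) (X_nilp ()), ev_X]

theorem qs_const (hh : IsPts G h) : (qs G h).constantCoeff = 0 := by
  obtain ⟨w, hw, e⟩ := nrm_X (τ := Unit) hh ()
  have : MvPowerSeries.constantCoeff (nrm G h (X () : MvPowerSeries Unit R)) = 0 := by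
    rw [e, map_mul, map_prod]
    rw [Finset.prod_eq_zero (Finset.mem_univ (1 : H)) (by simp [hh.one]), zero_mul]
  exact this

theorem sub1_qs (hh : IsPts G h) (i : τ) : sub1 (qs G h) i = nrm G h (X i : MvPowerSeries τ R) := by
  rw [sub1, PowerSeries.subst_def, subst_eq_ev (PowerSeries.HasSubst.X i).const]
  exact ev_qs hh (X_nilp i)

theorem subst_sub1_qs (hh : IsPts G h) (s : MvPowerSeries τ R) :
    subst (sub1 (qs G h)) s = ev (fun i => nrm G h (X i : MvPowerSeries τ R)) s := by
  rw [subst_eq_ev (sub1_hasSubst (qs_const hh))]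
  congr 1; funext i; exact sub1_qs hh i

variable [IsDomain R]

theorem qs_coeff_one (hh : IsPts G h) (hinj : Function.Injective h) : (qs G h).coeff 1 ≠ 0 := by
  classical
  obtain ⟨w, hw, e⟩ := nrm_X (τ := Unit) hh ()
  rw [← Finset.mul_prod_erase _ _ (Finset.mem_univ (1 : H)), hh.one, map_zero, sub_zero,
    mul_assoc] at e
  have e' : qs G h = PowerSeries.X * ((∏ a ∈ Finset.univ.erase (1 : H),
    (PowerSeries.X - PowerSeries.C (h a))) * w : PowerSeries R) := e
  rw [e', show (1 : ℕ) = 0 + 1 from rfl, PowerSeries.coeff_succ_X_mul,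
    PowerSeries.coeff_zero_eq_constantCoeff_apply, map_mul, map_prod]
  refine mul_ne_zero (Finset.prod_ne_zero_iff.2 fun a ha h0 => ?_) ?_
  · simp only [map_sub, PowerSeries.constantCoeff_X, zero_sub, PowerSeries.constantCoeff_C, neg_eq_zero] at h0
    exact (Finset.mem_erase.1 ha).1 (hinj (h0.trans hh.one.symm))
  · exact (hw.map (PowerSeries.constantCoeff (R := R))).ne_zero

theorem ev_nrm_X_injective (hh : IsPts G h) (hinj : Function.Injective h) :
    Function.Injective (fun s : MvPowerSeries τ R =>
      ev (fun i => nrm G h (X i : MvPowerSeries τ R)) s) := by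
  intro s t hst
  refine sub1_injective (qs_const hh) (qs_coeff_one hh hinj) ?_
  rw [subst_sub1_qs hh, subst_sub1_qs hh]; exact hst

theorem inv_decomp [G.IsComm] (hh : IsPts G h) (hinj : Function.Injective h) (S : Finset τ)
    {s : MvPowerSeries τ R} (hs : Inv G h s) :
    ∃ t : τ → MvPowerSeries τ R, (∀ i, Inv G h (t i)) ∧
      Inv G h (ev (fun i => if i ∈ S then 0 else X i : τ → MvPowerSeries τ R) s) ∧
      s = ev (fun i => if i ∈ S then 0 else X i : τ → MvPowerSeries τ R) s +
        ∑ i ∈ S, nrm G h (X i) * t i := by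
  have z : Inv G h (0 : MvPowerSeries τ R) := fun i a => ev_zero (upd_hasEval i (trans_nilp hh i a))
  induction S using Finset.induction_on with
  | empty =>
    have : ev (fun i => if i ∈ (∅ : Finset τ) then 0 else X i : τ → MvPowerSeries τ R) s = s := by
      simp only [Finset.notMem_empty, if_false]; exact ev_X_self s
    exact ⟨0, fun _ => z, by rwa [this], by rw [this]; simp⟩
  | insert j S hj ih =>
    obtain ⟨t, ht, hr, e⟩ := ih
    obtain ⟨s₁, hs₁, e₁⟩ := inv_step hh hinj j hr
    have n0 : IsTopologicallyNilpotent (0 : MvPowerSeries τ R) := nilp_zero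
    have E0 := upd_hasEval j n0
    have E1 : HasEval (fun i => if i ∈ S then 0 else X i : τ → MvPowerSeries τ R) :=
      hasEval_of_finite fun i => by
        show IsTopologicallyNilpotent (if i ∈ S then (0 : MvPowerSeries τ R) else X i)
        split_ifs
        exacts [n0, X_nilp i]
    have e2 : ev (upd j (0 : MvPowerSeries τ R))
        (ev (fun i => if i ∈ S then 0 else X i : τ → MvPowerSeries τ R) s) =
        ev (fun i => if i ∈ insert j S then 0 else X i : τ → MvPowerSeries τ R) s := by
      rw [ev_ev E1 E0]
      refine congrArg (fun f : τ → MvPowerSeries τ R => ev f s) (funext fun i => ?_)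
      by_cases h1 : i ∈ S
      · rw [if_pos h1, if_pos (Finset.mem_insert_of_mem h1), ev_zero E0]
      · rw [if_neg h1, ev_X]
        by_cases h2 : i = j
        · subst h2; rw [upd_same, if_pos (Finset.mem_insert_self _ _)]
        · rw [upd_ne h2, if_neg (by simp [h1, h2])]
    have hi := inv_ev_zero hh j hr
    rw [e2] at hi e₁
    refine ⟨fun i => if i = j then s₁ else t i, fun i => ?_, hi, ?_⟩
    · by_cases h2 : i = j
      · simpa [h2] using hs₁
      · simpa [h2] using ht i
    · have e3 : s = ev (fun i => if i ∈ insert j S then 0 else X i : τ → MvPowerSeries τ R) s +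
          (nrm G h (X j) * s₁ + ∑ i ∈ S, nrm G h (X i) * t i) := by rw [← add_assoc, ← e₁, ← e]
      refine e3.trans (congrArg _ ?_)
      rw [Finset.sum_insert hj]
      dsimp only
      rw [if_pos rfl]
      congr 1
      refine Finset.sum_congr rfl fun i hiS => ?_
      rw [if_neg]; rintro rfl; exact hj hiS

/-- A power series that is invariant under translation by `H` is a power series in the norms. -/
theorem descent [G.IsComm] (hh : IsPts G h) (hinj : Function.Injective h)
    {s : MvPowerSeries τ R} (hs : Inv G h s) :
    ∃ g : MvPowerSeries τ R, ev (fun i => nrm G h (X i : MvPowerSeries τ R)) g = s := by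
  obtain ⟨g, hg⟩ := sub1_surj (qs_const hh) (qs_coeff_one hh hinj) (Inv G h) (fun s hs => by
    obtain ⟨t, ht, -, e⟩ := inv_decomp hh hinj Finset.univ hs
    refine ⟨t, ht, ?_⟩
    have e0 : ev (fun i => if i ∈ (Finset.univ : Finset τ) then 0 else X i : τ → MvPowerSeries τ R) s
        = C (constantCoeff s) := by
      simp only [Finset.mem_univ, if_true]
      have := subst_zero_eq_C_constantCoeff (f := s) (S := R) (τ := τ)
      rw [Algebra.algebraMap_self, MvPowerSeries.map_id, RingHom.id_apply] at this
      rw [← this]; exact (subst_eq_ev HasSubst.zero s).symm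
    rw [e0] at e
    simpa only [sub1_qs hh] using e) s hs
  exact ⟨g, by rw [← subst_sub1_qs hh, hg]⟩

end Lubin2

section Quotient
variable {R : Type*} [CommRing R] [UniformSpace R] [IsUniformAddGroup R] [IsTopologicalRing R]
  [CompleteSpace R] [T2Space R] [IsLinearTopology R R]
variable {B : Type*} [CommRing B] [UniformSpace B] [IsUniformAddGroup B] [CompleteSpace B]
  [T2Space B] [IsTopologicalRing B] [IsLinearTopology B B] [Algebra R B] [ContinuousSMul R B]
variable {H : Type*} [CommGroup H] [Fintype H]
variable {G : FormalGroup R} {h : H → R} [IsDomain R]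

theorem ev_pair {τ : Type*} {a : τ → B} (ha : HasEval a) {u v : MvPowerSeries τ R}
    (hu : IsTopologicallyNilpotent u) (hv : IsTopologicallyNilpotent v)
    (g : MvPowerSeries (Fin 2) R) : ev a (ev ![u, v] g) = ev ![ev a u, ev a v] g := by
  rw [ev_ev (hasEval_pair hu hv) ha]
  congr 1; funext i; fin_cases i <;> rfl

theorem inv_nrm_fadd [G.IsComm] (hh : IsPts G h) :
    Inv G h (nrm G h (fadd G (X 0) (X 1)) : MvPowerSeries (Fin 2) R) := by
  intro i a
  have n0 := X_nilp (R := R) (0 : Fin 2)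
  have n1 := X_nilp (R := R) (1 : Fin 2)
  have nC := C_nilp (τ := Fin 2) (hh.nilp a)
  have E := upd_hasEval i (trans_nilp hh i a)
  have key := nrm_translate (B := MvPowerSeries (Fin 2) R) hh (fadd_nilp G n0 n1) a
  rw [← c_eq_algebraMap] at key
  rw [ev_nrm hh E (fadd_nilp G n0 n1), ev_fadd G E n0 n1, ev_X, ev_X]
  rw [← key]
  obtain rfl | rfl : i = 0 ∨ i = 1 := by fin_cases i <;> simp
  · show nrm G h (fadd G (upd (0 : Fin 2) _ 0) (upd (0 : Fin 2) _ 1)) = _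
    rw [upd_same, upd_ne (by decide), fadd_assoc G n0 nC n1, fadd_comm G nC n1,
      ← fadd_assoc G n0 n1 nC]
  · show nrm G h (fadd G (upd (1 : Fin 2) _ 0) (upd (1 : Fin 2) _ 1)) = _
    rw [upd_same, upd_ne (by decide), ← fadd_assoc G n0 n1 nC]

theorem coeff_ev_axis (g : MvPowerSeries (Fin 2) R) (i : Fin 2) (k : ℕ)
    {a : Fin 2 → MvPowerSeries Unit R} (h1 : a i = X ()) (h0 : ∀ j, j ≠ i → a j = 0) :
    coeff (Finsupp.single () k) (ev a g) = coeff (Finsupp.single i k) g := by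
  have hs : HasSubst a := hasSubst_of_constantCoeff_zero fun j => by
    by_cases hj : j = i
    · subst hj; rw [h1]; simp
    · rw [h0 j hj]; simp
  rw [← subst_eq_ev hs, coeff_subst hs, finsum_eq_single _ (Finsupp.single i k)]
  · rw [Finsupp.prod_single_index (by simp), h1, X_pow_eq, coeff_monomial_same, smul_eq_mul, mul_one]
  · intro d hd
    by_cases hj : ∃ j, j ≠ i ∧ d j ≠ 0
    · obtain ⟨j, hj, hdj⟩ := hj
      rw [Finsupp.prod, Finset.prod_eq_zero (i := j) (by simpa using hdj)
        (by rw [h0 j hj, zero_pow hdj]), map_zero, smul_zero]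
    · push Not at hj
      have hd' : d = Finsupp.single i (d i) := by
        ext j
        by_cases hji : j = i
        · subst hji; simp
        · rw [hj j hji, Finsupp.single_eq_of_ne hji]
      rw [hd', Finsupp.prod_single_index (by simp), h1, X_pow_eq, coeff_monomial_ne, smul_zero]
      intro h2
      apply hd
      rw [hd', (Finsupp.single_injective () h2).symm]

/-- The quotient of a formal group by a finite group of points. -/
theorem exists_quotient [G.IsComm] (hh : IsPts G h) (hinj : Function.Injective h) :
    ∃ G' : FormalGroup R, G'.IsComm ∧
      fadd G' (nrm G h (X 0)) (nrm G h (X 1)) =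
        nrm G h (fadd G (X 0) (X 1) : MvPowerSeries (Fin 2) R) := by
  obtain ⟨g, hg⟩ := descent hh hinj (inv_nrm_fadd (G := G) hh)
  have hg2 : ev ![nrm G h (X 0), nrm G h (X 1)] g =
      nrm G h (fadd G (X 0) (X 1) : MvPowerSeries (Fin 2) R) := by
    rw [← hg]; congr 1; funext i; fin_cases i <;> rfl
  have n0 := X_nilp (R := R) (0 : Fin 2)
  have n1 := X_nilp (R := R) (1 : Fin 2)
  have P : ∀ {σ : Type} {a b : MvPowerSeries σ R}, IsTopologicallyNilpotent a →
      IsTopologicallyNilpotent b → ev ![nrm G h a, nrm G h b] g = nrm G h (fadd G a b) := by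
    intro σ a b ha hb
    have E := hasEval_pair ha hb
    have nn0 := nrm_nilp hh n0
    have nn1 := nrm_nilp hh n1
    have n01 := fadd_nilp G n0 n1
    have := congrArg (ev ![a, b]) hg2
    rw [ev_pair E nn0 nn1, ev_nrm hh E n0, ev_nrm hh E n1,
      ev_nrm hh E n01, ev_fadd G E n0 n1, ev_X, ev_X] at this
    exact this
  have nX := X_nilp (R := R) ()
  have nZ : IsTopologicallyNilpotent (0 : MvPowerSeries Unit R) := nilp_zero
  have EN : HasEval (fun i : Unit => nrm G h (X i : MvPowerSeries Unit R)) :=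
    hasEval_of_finite fun i => nrm_nilp hh (X_nilp i)
  have ax0 : ev ![X (), 0] g = (X () : MvPowerSeries Unit R) := by
    apply ev_nrm_X_injective hh hinj
    show ev (fun i : Unit => nrm G h (X i : MvPowerSeries Unit R)) _ =
      ev (fun i : Unit => nrm G h (X i : MvPowerSeries Unit R)) _
    have := P nX nZ
    rw [nrm_zero hh, fadd_zero G nX] at this
    rw [ev_pair EN nX nZ, ev_X, ev_zero EN, this]
  have ax1 : ev ![0, X ()] g = (X () : MvPowerSeries Unit R) := by
    apply ev_nrm_X_injective hh hinj
    show ev (fun i : Unit => nrm G h (X i : MvPowerSeries Unit R)) _ =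
      ev (fun i : Unit => nrm G h (X i : MvPowerSeries Unit R)) _
    have := P nZ nX
    rw [nrm_zero hh, zero_fadd G nX] at this
    rw [ev_pair EN nZ nX, ev_X, ev_zero EN, this]
  have c0 : ∀ k, coeff (Finsupp.single 0 k) g = coeff (Finsupp.single () k) (X () : MvPowerSeries Unit R) := by
    intro k
    rw [← ax0]
    refine (coeff_ev_axis g 0 k rfl fun j hj => ?_).symm
    fin_cases j
    · exact absurd rfl hj
    · rfl
  have c1 : ∀ k, coeff (Finsupp.single 1 k) g = coeff (Finsupp.single () k) (X () : MvPowerSeries Unit R) := by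
    intro k
    rw [← ax1]
    refine (coeff_ev_axis g 1 k rfl fun j hj => ?_).symm
    fin_cases j
    · rfl
    · exact absurd rfl hj
  have const : constantCoeff g = 0 := by
    have := c0 0
    simpa using this
  have nP : ∀ {σ : Type} {a b : MvPowerSeries σ R}, IsTopologicallyNilpotent a →
      IsTopologicallyNilpotent b → IsTopologicallyNilpotent (ev ![a, b] g) := by
    intro σ a b ha hb
    exact ev_nilp (by intro i; fin_cases i <;> assumption) const
  have S : ∀ {σ : Type} {a b : MvPowerSeries σ R}, PowerSeries.HasSubst a →
      PowerSeries.HasSubst b → g.subst ![a, b] = ev ![a, b] g := fun ha hb =>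
    subst_eq_ev (hasSubst_of_constantCoeff_nilpotent (by intro s; fin_cases s <;> assumption)) _
  have HS : ∀ i j : Fin 3, PowerSeries.HasSubst (g.subst ![X i, X j] : MvPowerSeries (Fin 3) R) := by
    intro i j
    apply PowerSeries.HasSubst.of_constantCoeff_zero
    exact constantCoeff_subst_eq_zero HasSubst.X_X (by intro i; fin_cases i <;> simp) const
  have x0 := X_nilp (R := R) (0 : Fin 3)
  have x1 := X_nilp (R := R) (1 : Fin 3)
  have x2 := X_nilp (R := R) (2 : Fin 3)
  have E3 : HasEval (fun i : Fin 3 => nrm G h (X i : MvPowerSeries (Fin 3) R)) :=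
    hasEval_of_finite fun i => nrm_nilp hh (X_nilp i)
  have E2 : HasEval (fun i : Fin 2 => nrm G h (X i : MvPowerSeries (Fin 2) R)) :=
    hasEval_of_finite fun i => nrm_nilp hh (X_nilp i)
  have hX3 : ∀ i : Fin 3, PowerSeries.HasSubst (X i : MvPowerSeries (Fin 3) R) :=
    fun i => PowerSeries.HasSubst.X i
  have assoc : g.subst ![g.subst ![X 0, X 1], X 2] =
      g.subst ![X 0, g.subst ![X 1, (X 2 : MvPowerSeries (Fin 3) R)]] := by
    apply ev_nrm_X_injective hh hinj
    show ev (fun i : Fin 3 => nrm G h (X i : MvPowerSeries (Fin 3) R)) _ =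
      ev (fun i : Fin 3 => nrm G h (X i : MvPowerSeries (Fin 3) R)) _
    have n01 := nP x0 x1
    have n12 := nP x1 x2
    have f01 := fadd_nilp G x0 x1
    have f12 := fadd_nilp G x1 x2
    rw [S (HS 0 1) (hX3 2), S (hX3 0) (HS 1 2), S (hX3 0) (hX3 1), S (hX3 1) (hX3 2),
      ev_pair E3 n01 x2, ev_pair E3 x0 n12, ev_pair E3 x0 x1, ev_pair E3 x1 x2,
      ev_X, ev_X, ev_X, P x0 x1, P x1 x2, P f01 x2, P x0 f12,
      fadd_assoc G x0 x1 x2]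
  refine ⟨⟨g, const, ?_, ?_, assoc⟩, ⟨?_⟩, hg2⟩
  · rw [c0, coeff_index_single_self_X]
  · rw [c1, coeff_index_single_self_X]
  · show g = g.subst ![X 1, X 0]
    apply ev_nrm_X_injective hh hinj
    show ev (fun i : Fin 2 => nrm G h (X i : MvPowerSeries (Fin 2) R)) _ =
      ev (fun i : Fin 2 => nrm G h (X i : MvPowerSeries (Fin 2) R)) _
    rw [S (PowerSeries.HasSubst.X _) (PowerSeries.HasSubst.X _), ev_pair E2 n1 n0, ev_X, ev_X,
      P n1 n0, hg, fadd_comm G n1 n0]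

variable {G' : FormalGroup R}

theorem fadd_quotient (hh : IsPts G h)
    (hG' : fadd G' (nrm G h (X 0)) (nrm G h (X 1)) =
        nrm G h (fadd G (X 0) (X 1) : MvPowerSeries (Fin 2) R))
    {a b : B} (ha : IsTopologicallyNilpotent a) (hb : IsTopologicallyNilpotent b) :
    fadd G' (nrm G h a) (nrm G h b) = nrm G h (fadd G a b) := by
  have n0 := X_nilp (R := R) (0 : Fin 2)
  have n1 := X_nilp (R := R) (1 : Fin 2)
  have E := hasEval_pair ha hb
  have nn0 := nrm_nilp hh n0
  have nn1 := nrm_nilp hh n1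
  have n01 := fadd_nilp G n0 n1
  have := congrArg (ev ![a, b]) hG'
  rw [ev_fadd G' E nn0 nn1, ev_nrm hh E n0, ev_nrm hh E n1,
    ev_nrm hh E n01, ev_fadd G E n0 n1, ev_X, ev_X] at this
  exact this

theorem quotient_unique (hh : IsPts G h) (hinj : Function.Injective h) {G'' : FormalGroup R}
    (h1 : fadd G' (nrm G h (X 0)) (nrm G h (X 1)) =
        nrm G h (fadd G (X 0) (X 1) : MvPowerSeries (Fin 2) R))
    (h2 : fadd G'' (nrm G h (X 0)) (nrm G h (X 1)) =
        nrm G h (fadd G (X 0) (X 1) : MvPowerSeries (Fin 2) R)) : G' = G'' := by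
  apply FormalGroup.ext
  apply ev_nrm_X_injective hh hinj
  have : (fun i : Fin 2 => nrm G h (X i : MvPowerSeries (Fin 2) R)) =
    ![nrm G h (X 0), nrm G h (X 1)] := by funext i; fin_cases i <;> rfl
  show ev (fun i : Fin 2 => nrm G h (X i : MvPowerSeries (Fin 2) R)) _ =
      ev (fun i : Fin 2 => nrm G h (X i : MvPowerSeries (Fin 2) R)) _
  rw [this]
  exact h1.trans h2.symm

end Quotient

section Level
variable {R : Type*} [CommRing R] [UniformSpace R] [IsUniformAddGroup R] [IsTopologicalRing R]
  [CompleteSpace R] [T2Space R] [IsLinearTopology R R]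
variable {A : Type*} [CommGroup A] [Fintype A]
variable {G : FormalGroup R} {l : A → R}

/-- The divisor `∑ [l a]` of `l : A → G(R)`, cut out by the polynomial `g(x) = ∏ (x - l a)`, is a
subgroup scheme of `G`: the function `g(x +_G y)` vanishes on the product of the divisor with
itself. (It contains the origin and is stable under inversion because `l` is a homomorphism.) -/
def IsLevel (G : FormalGroup R) (l : A → R) : Prop :=
  ∏ a, (G.toPowerSeries - C (l a)) ∈
    Ideal.span {∏ a, (X 0 - C (l a)), ∏ a, (X 1 - C (l a) : MvPowerSeries (Fin 2) R)}

theorem ev_prod_X_sub_C {σ : Type*} {a : Fin 2 → MvPowerSeries σ R} (ha : HasEval a)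
    (f : MvPowerSeries (Fin 2) R) (S : Finset A) :
    ev a (∏ c ∈ S, (f - C (l c))) = ∏ c ∈ S, (ev a f - C (l c)) := by
  rw [ev_eq_aeval ha, map_prod]
  refine Finset.prod_congr rfl fun c _ => ?_
  rw [map_sub, ← ev_eq_aeval, ← ev_eq_aeval, ev_C, ← c_eq_algebraMap]

variable [IsDomain R]

theorem level_aux (hnil : ∀ a, IsTopologicallyNilpotent (l a)) (hinj : Function.Injective l)
    (I : Ideal (MvPowerSeries (Fin 2) R)) (hI : ∏ a, (X 1 - C (l a)) ∈ I) (S : Finset A) :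
    ∀ s : MvPowerSeries (Fin 2) R,
    (∀ a ∈ S, ∀ b, ev (upd (1 : Fin 2) (C (l b))) (ev (upd (0 : Fin 2) (C (l a))) s) = 0) →
    s ∈ I ⊔ Ideal.span {∏ a ∈ S, (X 0 - C (l a))} := by
  classical
  induction S using Finset.induction_on with
  | empty => intro s _; simp
  | insert a S ha ih =>
    intro s hs
    have nC : ∀ c, IsTopologicallyNilpotent (C (l c) : MvPowerSeries (Fin 2) R) :=
      fun c => C_nilp (hnil c)
    have E : ∀ (i : Fin 2) (c : A), HasEval (upd i (C (l c)) : Fin 2 → MvPowerSeries (Fin 2) R) :=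
      fun i c => upd_hasEval i (nC c)
    obtain ⟨t, ht⟩ := dvd_sub_ev (0 : Fin 2) (hnil a) s
    have h1 : ev (upd (0 : Fin 2) (C (l a))) s ∈ I := by
      refine Ideal.mem_of_dvd _ ?_ hI
      exact prod_dvd_of_roots 1 l hinj hnil _ _ fun b _ => hs a (Finset.mem_insert_self _ _) b
    have h2 : t ∈ I ⊔ Ideal.span {∏ a ∈ S, (X 0 - C (l a))} := by
      refine ih t fun c hc b => ?_
      have := congrArg (fun u => ev (upd (1 : Fin 2) (C (l b))) (ev (upd (0 : Fin 2) (C (l c))) u)) ht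
      have nt : ∀ r : R, ∀ (i : Fin 2) (c : A), ev (upd i (C (l c))) (C r : MvPowerSeries (Fin 2) R)
          = C r := fun r i c => ev_C r
      rw [ev_sub (E 0 c), ev_sub (E 1 b), ev_mul (E 0 c), ev_mul (E 1 b), ev_sub (E 0 c), ev_X,
        upd_same, nt, ev_sub (E 1 b), nt, nt, hs c (Finset.mem_insert_of_mem hc) b,
        ev_upd_upd 0 (nC a) (nC c), nt, hs a (Finset.mem_insert_self _ _) b, sub_zero] at this
      refine (mul_eq_zero.1 this.symm).resolve_left fun h0 => ha ?_
      rw [← map_sub] at h0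
      have h3 := congrArg constantCoeff h0
      rw [constantCoeff_C, map_zero, sub_eq_zero] at h3
      exact hinj h3 ▸ hc
    rw [Finset.prod_insert ha]
    have e : s = ev (upd (0 : Fin 2) (C (l a))) s + (X 0 - C (l a)) * t := by rw [← ht]; ring
    rw [e]
    refine Ideal.add_mem _ (Ideal.mem_sup_left h1) ?_
    obtain ⟨u, hu, v, hv, rfl⟩ := Submodule.mem_sup.1 h2
    rw [mul_add]
    refine Ideal.add_mem _ (Ideal.mem_sup_left (I.mul_mem_left _ hu)) (Ideal.mem_sup_right ?_)
    rw [Ideal.mem_span_singleton] at hv ⊢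
    exact mul_dvd_mul_left _ hv

theorem isLevel_of_injective (hl : IsPts G l) (hinj : Function.Injective l) : IsLevel G l := by
  have nC : ∀ c, IsTopologicallyNilpotent (C (l c) : MvPowerSeries (Fin 2) R) :=
    fun c => C_nilp (hl.nilp c)
  have := level_aux hl.nilp hinj (Ideal.span {∏ a, (X 1 - C (l a))})
    (Ideal.mem_span_singleton_self _) Finset.univ (∏ a, (G.toPowerSeries - C (l a))) (by
    intro a _ b
    have E0 := upd_hasEval (0 : Fin 2) (nC a)
    have E1 := upd_hasEval (1 : Fin 2) (nC b)
    rw [ev_prod_X_sub_C E0, ev_prod_X_sub_C E1, ev_ev E0 E1]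
    refine Finset.prod_eq_zero (Finset.mem_univ (a * b)) ?_
    rw [sub_eq_zero, hl.mul, c_eq_algebraMap, algebraMap_fadd (hl.nilp a) (hl.nilp b), fadd,
      ← c_eq_algebraMap]
    congr 1; funext i
    obtain rfl | rfl : i = 0 ∨ i = 1 := by fin_cases i <;> simp
    · rw [upd_same, ev_C]; rfl
    · rw [upd_ne (by decide), ev_X, upd_same]; rfl)
  rw [sup_comm, ← Ideal.span_union] at this
  exact this

theorem injective_of_isLevel [CharZero R] (hl : IsPts G l) (h : IsLevel G l) :
    Function.Injective l := by
  classical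
  have hker : ∀ a, l a = 0 → a = 1 := by
    by_contra! hc
    obtain ⟨a₀, ha₀, ha₁⟩ := hc
    let K : Finset A := Finset.univ.filter fun a => l a = 0
    have hK : 2 ≤ K.card := by
      have : ({a₀, 1} : Finset A) ⊆ K := by
        intro x hx
        simp only [Finset.mem_insert, Finset.mem_singleton] at hx
        rcases hx with rfl | rfl
        · simp [K, ha₀]
        · simp [K, hl.one]
      simpa [Finset.card_pair ha₁] using Finset.card_le_card this
    obtain ⟨d, hd⟩ : ∃ d, K.card = d + 2 := ⟨K.card - 2, by omega⟩
    have split : ∀ f : MvPowerSeries (Fin 2) R,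
        ∏ a, (f - C (l a)) = f ^ (d + 2) * ∏ a ∈ Kᶜ, (f - C (l a)) := by
      intro f
      rw [← Finset.prod_mul_prod_compl K, ← hd, ← Finset.prod_const]
      congr 1
      refine Finset.prod_congr rfl fun a ha => ?_
      rw [(Finset.mem_filter.1 ha).2, map_zero, sub_zero]
    have e1 : ev (upd (1 : Fin 2) 0) G.toPowerSeries = (X 0 : MvPowerSeries (Fin 2) R) := by
      rw [← fadd_zero G (X_nilp (R := R) (0 : Fin 2)), fadd]
      congr 1; funext i
      obtain rfl | rfl : i = 0 ∨ i = 1 := by fin_cases i <;> simp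
      · exact upd_ne (by decide) _
      · exact upd_same _ _
    obtain ⟨b, hb⟩ := X_dvd_sub_ev_zero (1 : Fin 2) G.toPowerSeries
    rw [e1, sub_eq_iff_eq_add] at hb
    have hX : ∀ (i : Fin 2) (k : ℕ) (w : MvPowerSeries (Fin 2) R) (m : Fin 2 →₀ ℕ), m i < k →
        coeff m (X i ^ k * w) = 0 := by
      intro i k w m hm
      rw [X_pow_eq, coeff_monomial_mul, if_neg]
      intro hle
      have := hle i
      rw [Finsupp.single_eq_same] at this
      omega
    let m : Fin 2 →₀ ℕ := Finsupp.single 0 (d + 1) + Finsupp.single 1 1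
    have m0 : m 0 = d + 1 := by simp [m]
    have m1 : m 1 = 1 := by simp [m]
    have hb0 : constantCoeff b = 1 := by
      have := G.lin_coeff_Y
      rw [hb, map_add] at this
      have h2 : coeff (Finsupp.single 1 1) (X 1 * b) = constantCoeff b := by
        have := coeff_add_monomial_mul (Finsupp.single (1 : Fin 2) 1) 0 b (1 : R)
        simpa [X] using this
      rw [h2, coeff_X, if_neg, add_zero] at this
      · exact this
      · intro h; have := DFunLike.congr_fun h 0; simp at this
    let U := ∏ a ∈ Kᶜ, (G.toPowerSeries - C (l a))
    have hU : constantCoeff U ≠ 0 := by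
      simp only [U, map_prod]
      refine Finset.prod_ne_zero_iff.2 fun a ha h0 => ?_
      rw [map_sub, G.zero_constantCoeff, constantCoeff_C, zero_sub, neg_eq_zero] at h0
      exact (Finset.mem_compl.1 ha) (Finset.mem_filter.2 ⟨Finset.mem_univ _, h0⟩)
    have hL : coeff m (∏ a, (G.toPowerSeries - C (l a))) = (d + 2 : ℕ) * constantCoeff U := by
      rw [split]
      obtain ⟨k, hk⟩ := Polynomial.powAddExpansion (X 0 : MvPowerSeries (Fin 2) R) (X 1 * b) (d + 2)
      have : G.toPowerSeries ^ (d + 2) * U = X 0 ^ (d + 2) * U +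
          monomial m (1 : R) * (C ((d + 2 : ℕ) : R) * (b * U)) + X 1 ^ 2 * (k * b ^ 2 * U) := by
        have hm : monomial m (1 : R) = X 0 ^ (d + 1) * X 1 := by
          rw [X_pow_eq, X, monomial_mul_monomial, one_mul]
        rw [hb, add_comm, hk, hm, map_natCast]
        simp only [show d + 2 - 1 = d + 1 from rfl]
        ring
      rw [this, map_add, map_add, hX 0 _ _ _ (by omega), hX 1 _ _ _ (by omega), zero_add, add_zero]
      have h3 := coeff_add_monomial_mul m 0 (C ((d + 2 : ℕ) : R) * (b * U)) (1 : R)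
      rw [add_zero, one_mul, coeff_zero_eq_constantCoeff_apply] at h3
      rw [h3, map_mul constantCoeff, map_mul constantCoeff, constantCoeff_C, hb0, one_mul]
    obtain ⟨u, v, huv⟩ := Ideal.mem_span_pair.1 h
    rw [split, split] at huv
    have h4 := congrArg (coeff m) huv
    rw [hL, map_add, mul_comm u, mul_comm v, mul_assoc, mul_assoc, hX 0 _ _ _ (by omega),
      hX 1 _ _ _ (by omega), add_zero] at h4
    rcases mul_eq_zero.1 h4.symm with h5 | h5
    · exact absurd (Nat.cast_eq_zero.1 h5) (by omega)
    · exact hU h5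
  intro a b hab
  have : l (a * b⁻¹) = 0 := by
    rw [hl.mul, hab, ← hl.mul, mul_inv_cancel, hl.one]
  exact mul_inv_eq_one.1 (hker _ this)

end Level

section Deform

/-- An isomorphism `t` of formal group laws. -/
structure IsIso {k : Type*} [CommRing k] (G₁ G₂ : FormalGroup k) (t : PowerSeries k) : Prop where
  const : t.constantCoeff = 0
  unit : IsUnit (t.coeff 1)
  hom : PowerSeries.subst G₁.toPowerSeries t = G₂.toPowerSeries.subst (sub1 t)

universe u

/-- A complete local domain of characteristic zero. The universal rings of level structures on
deformations of a formal group of finite height are of this kind. -/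
structure TestRing : Type (u + 1) where
  carrier : Type u
  [commRing : CommRing carrier]
  [isLocalRing : IsLocalRing carrier]
  [isDomain : IsDomain carrier]
  [charZero : CharZero carrier]
  [complete : IsAdicComplete (IsLocalRing.maximalIdeal carrier) carrier]

instance : CoeSort TestRing.{u} (Type u) := ⟨TestRing.carrier⟩

variable (R : TestRing.{u})

instance : CommRing R := R.commRing
instance : IsLocalRing R := R.isLocalRing
instance : IsDomain R := R.isDomain
instance : CharZero R := R.charZero
instance : IsAdicComplete (IsLocalRing.maximalIdeal R) R := R.complete
instance : WithIdeal R := ⟨IsLocalRing.maximalIdeal R⟩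
theorem TestRing.isAdic : IsAdic (IsLocalRing.maximalIdeal R) := rfl
instance : CompleteSpace R := ((R.isAdic.isAdicComplete_iff).1 inferInstance).1
instance : T2Space R := ((R.isAdic.isAdicComplete_iff).1 inferInstance).2

theorem TestRing.nilp_iff {R : TestRing.{u}} {r : R} :
    IsTopologicallyNilpotent r ↔ r ∈ IsLocalRing.maximalIdeal R := by
  refine ⟨fun h => ?_, fun h => WithIdeal.isTopologicallyNilpotent_of_mem h⟩
  have h1 : (IsLocalRing.maximalIdeal R : Set R) ∈ 𝓝 (0 : R) := by
    have := (R.isAdic.hasBasis_nhds_zero).mem_of_mem (i := 1) trivial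
    simpa using this
  obtain ⟨n, hn⟩ := (h.eventually h1).exists
  exact (IsLocalRing.maximalIdeal.isMaximal R).isPrime.mem_of_pow_mem _ hn

/-- The residue field. -/
abbrev TestRing.K (R : TestRing.{u}) : Type u := IsLocalRing.ResidueField R

/-- The reduction map. -/
abbrev TestRing.res (R : TestRing.{u}) : R →+* R.K := IsLocalRing.residue R

variable {κ : Type u} [Field κ]

/-- A deformation `(G, i, τ)` over `R` of the formal group `F` over `κ`, with a level structure
`l : A → G(R)`. Here `G(R)` is the maximal ideal (which consists of the topologically nilpotent
elements) with addition given by `G`. -/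
structure LevelObj (F : FormalGroup κ) (A : Type*) [CommGroup A] [Fintype A] (R : TestRing.{u}) where
  G : FormalGroup R
  comm : G.IsComm
  i : κ →+* R.K
  τ : PowerSeries R.K
  τ_iso : IsIso (G.map R.res) (F.map i) τ
  l : A → R
  pts : IsPts G l
  level : IsLevel G l

variable {R} {F : FormalGroup κ} {A A₁ A₂ A₃ : Type*} [CommGroup A] [Fintype A] [CommGroup A₁]
  [Fintype A₁] [CommGroup A₂] [Fintype A₂] [CommGroup A₃] [Fintype A₃]

instance kerFintype (φ : A₁ →* A₂) : Fintype φ.ker := Fintype.ofFinite _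

/-- The restriction of `l : A₁ → G(R)` to the kernel of `φ : A₁ → A₂`. -/
def kerPts (φ : A₁ →* A₂) (l : A₁ → R) : φ.ker → R := fun a => l a

/-- For a surjection `φ : A₁ → A₂` with kernel `H` of order `p ^ k`, the object `y` is the quotient
`(G/H, i ∘ σ^k, τ/H)` of `x = (G, i, τ)`, with the level structure `A₂ ≅ A₁/H → G/H` induced by `l`.
The quotient map `q : G → G/H` is `q(X) = ∏_{a ∈ H} (X +_G l a)`, and `τ/H` is determined by
`τ/H ∘ q = Frob^k ∘ τ`. -/
structure IsQuot (φ : A₁ →* A₂) (x : LevelObj F A₁ R) (y : LevelObj F A₂ R) : Prop where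
  group : fadd y.G (nrm x.G (kerPts φ x.l) (X 0)) (nrm x.G (kerPts φ x.l) (X 1)) =
    nrm x.G (kerPts φ x.l) (fadd x.G (X 0) (X 1) : MvPowerSeries (Fin 2) R)
  i : ∀ c, y.i c = x.i (c ^ Fintype.card φ.ker)
  τ : y.τ.subst (PowerSeries.map R.res (qs x.G (kerPts φ x.l))) = x.τ ^ Fintype.card φ.ker
  l : ∀ a, y.l (φ a) = nrm x.G (kerPts φ x.l) (x.l a)

theorem LevelObj.ext' {x y : LevelObj F A R} (hG : x.G = y.G) (hi : x.i = y.i) (hτ : x.τ = y.τ)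
    (hl : x.l = y.l) : x = y := by
  cases x; cases y; cases hG; cases hi; cases hτ; cases hl; rfl

theorem LevelObj.injective (x : LevelObj F A R) : Function.Injective x.l :=
  injective_of_isLevel x.pts x.level

theorem IsPts.ker {G : FormalGroup R} {l : A₁ → R} (hl : IsPts G l) (φ : A₁ →* A₂) :
    IsPts G (kerPts φ l) :=
  ⟨fun a => hl.nilp a, hl.one, fun a b => hl.mul a b⟩

theorem kerPts_injective {l : A₁ → R} (hl : Function.Injective l) (φ : A₁ →* A₂) :
    Function.Injective (kerPts φ l) := fun _ _ h => Subtype.ext (hl h)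

section Reduction
variable {H : Type*} [CommGroup H] [Fintype H] {G : FormalGroup R} {h : H → R}
variable {σ : Type*} [Finite σ] [DecidableEq σ]

theorem red_nrm (hh : IsPts G h) {b : MvPowerSeries σ R} (hb : IsTopologicallyNilpotent b) :
    (nrm G h b).map R.res = (b.map R.res) ^ Fintype.card H := by
  obtain ⟨u, hu⟩ := fadd_eq_add_mul (τ := σ) G
  rw [nrm, map_prod, ← Finset.card_univ, ← Finset.prod_const]
  refine Finset.prod_congr rfl fun a _ => ?_
  have h0 : R.res (h a) = 0 :=
    (IsLocalRing.residue_eq_zero_iff _).2 (TestRing.nilp_iff.1 (hh.nilp a))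
  rw [← c_eq_algebraMap, hu b _ hb (C_nilp (hh.nilp a)), map_add, map_mul, map_C, h0, map_zero,
    zero_mul, add_zero]

theorem red_qs (hh : IsPts G h) :
    PowerSeries.map R.res (qs G h) = PowerSeries.X ^ Fintype.card H := by
  have := red_nrm hh (X_nilp (R := R) ())
  rw [map_X] at this
  exact this

theorem expand_inj {k : Type*} [CommRing k] {N : ℕ} (hN : N ≠ 0) {f g : MvPowerSeries σ k}
    (h : expand N hN f = expand N hN g) : f = g := by
  ext m
  rw [← coeff_expand_smul N hN, h, coeff_expand_smul]

variable {p j : ℕ} [Fact p.Prime] [ExpChar R.K p]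

theorem red_group {G' : FormalGroup R} (hh : IsPts G h) (hj : Fintype.card H = p ^ j)
    (hG : fadd G' (nrm G h (X 0)) (nrm G h (X 1)) =
      nrm G h (fadd G (X 0) (X 1) : MvPowerSeries (Fin 2) R)) :
    G'.map R.res = (G.map R.res).map (iterateFrobenius R.K p j) := by
  have hp : p ≠ 0 := (Fact.out : p.Prime).ne_zero
  have n0 := X_nilp (R := R) (0 : Fin 2)
  have n1 := X_nilp (R := R) (1 : Fin 2)
  have hX : fadd G (X 0) (X 1) = G.toPowerSeries := by
    rw [fadd]
    refine Eq.trans ?_ (ev_X_self _)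
    congr 1; funext i
    obtain rfl | rfl : i = 0 ∨ i = 1 := by fin_cases i <;> simp
    · rfl
    · rfl
  have hs : (![nrm G h (X 0), nrm G h (X 1)] : Fin 2 → MvPowerSeries (Fin 2) R) =
      sub1 (qs G h) := by
    funext i
    rw [sub1_qs hh]
    obtain rfl | rfl : i = 0 ∨ i = 1 := by fin_cases i <;> simp
    · rfl
    · rfl
  have key := congrArg (MvPowerSeries.map R.res) hG
  rw [red_nrm hh (fadd_nilp G n0 n1), hX, fadd, hs, ← subst_eq_ev (sub1_hasSubst (qs_const hh)),
    map_subst (sub1_hasSubst (qs_const hh)), hj] at key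
  apply FormalGroup.ext
  apply expand_inj (pow_ne_zero j hp)
  rw [FormalGroup.map_toPowerSeries, FormalGroup.map_toPowerSeries, FormalGroup.map_toPowerSeries,
    ← map_expand (p ^ j) _ (iterateFrobenius R.K p j), map_iterateFrobenius_expand p hp, ← key,
    expand, substAlgHom_apply]
  congr 1; funext i
  rw [sub1_map, red_qs hh, hj, sub1, PowerSeries.subst_pow (PowerSeries.HasSubst.X i),
    PowerSeries.subst_X (PowerSeries.HasSubst.X i)]

theorem red_tau {k : Type*} [CommRing k] [ExpChar k p] {s t : PowerSeries k} :
    s.subst (PowerSeries.X ^ (p ^ j) : PowerSeries k) = t ^ (p ^ j) ↔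
      s = t.map (iterateFrobenius k p j) := by
  have hp : p ≠ 0 := (Fact.out : p.Prime).ne_zero
  have h1 : t ^ (p ^ j) = expand (p ^ j) (pow_ne_zero j hp) (t.map (iterateFrobenius k p j)) := by
    have := map_iterateFrobenius_expand p hp (R := k) (σ := Unit) t j
    rw [map_expand] at this
    exact this.symm
  have h2 : s.subst (PowerSeries.X ^ (p ^ j) : PowerSeries k) =
      expand (p ^ j) (pow_ne_zero j hp) s := by
    rw [expand, substAlgHom_apply]; rfl
  rw [h1, h2]
  exact ⟨fun h => expand_inj _ h, fun h => by rw [h]⟩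

end Reduction

end Deform

section QuotientObj
universe u
variable {κ : Type u} [Field κ]
variable {R : TestRing.{u}} {F : FormalGroup κ} {A A₁ A₂ A₃ : Type*} [CommGroup A] [Fintype A]
  [CommGroup A₁] [Fintype A₁] [CommGroup A₂] [Fintype A₂] [CommGroup A₃] [Fintype A₃]

theorem IsIso.map {k k' : Type*} [CommRing k] [CommRing k'] {G₁ G₂ : FormalGroup k}
    {t : PowerSeries k} (ht : IsIso G₁ G₂ t) (f : k →+* k') :
    IsIso (G₁.map f) (G₂.map f) (t.map f) := by
  refine ⟨map_const f ht.const, ?_, ?_⟩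
  · rw [PowerSeries.coeff_map]; exact ht.unit.map f
  · have hG : PowerSeries.HasSubst G₁.toPowerSeries :=
      PowerSeries.HasSubst.of_constantCoeff_zero G₁.zero_constantCoeff
    have := congrArg (MvPowerSeries.map f) ht.hom
    rw [PowerSeries.map_subst hG, MvPowerSeries.map_subst (sub1_hasSubst ht.const)] at this
    refine this.trans ?_
    rw [FormalGroup.map_toPowerSeries]
    congr 1; funext i; exact sub1_map f t i

theorem nrm_eq_of_eq {φ : A₁ →* A₂} {G : FormalGroup R} (hG : G.IsComm) {l : A₁ → R} (hl : IsPts G l)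
    {a b : A₁} (h : φ a = φ b) : nrm G (kerPts φ l) (l a) = nrm G (kerPts φ l) (l b) := by
  have hk : a⁻¹ * b ∈ φ.ker := by rw [MonoidHom.mem_ker, map_mul, map_inv, h, inv_mul_cancel]
  have := nrm_translate (hl.ker φ) (hl.nilp a) ⟨a⁻¹ * b, hk⟩
  rw [← this]
  congr 1
  have h2 := hl.mul a (a⁻¹ * b)
  rw [mul_inv_cancel_left] at h2
  exact h2.symm

theorem IsQuot.unique {φ : A₁ →* A₂} (hφ : Function.Surjective φ) {p : ℕ} [Fact p.Prime] [CharP κ p]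
    (hp : ∃ j, Fintype.card φ.ker = p ^ j)
    {x : LevelObj F A₁ R} {y z : LevelObj F A₂ R} (hy : IsQuot φ x y) (hz : IsQuot φ x z) : y = z := by
  have := x.comm
  obtain ⟨j, hj⟩ := hp
  have : ExpChar κ p := ExpChar.prime Fact.out
  have : ExpChar R.K p := expChar_of_injective_ringHom x.i.injective p
  refine LevelObj.ext' ?_ ?_ ?_ ?_
  · exact quotient_unique (x.pts.ker φ) (kerPts_injective x.injective φ) hy.group hz.group
  · ext c; rw [hy.i, hz.i]
  · have h1 := hy.τ
    have h2 := hz.τ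
    rw [red_qs (x.pts.ker φ), hj, red_tau] at h1 h2
    rw [h1, h2]
  · funext c
    obtain ⟨a, rfl⟩ := hφ c
    rw [hy.l, hz.l]

theorem exists_isQuot {φ : A₁ →* A₂} (hφ : Function.Surjective φ) {p : ℕ} [Fact p.Prime] [CharP κ p]
    (hp : ∃ j, Fintype.card φ.ker = p ^ j) (x : LevelObj F A₁ R) :
    ∃ y : LevelObj F A₂ R, IsQuot φ x y := by
  have := x.comm
  obtain ⟨j, hj⟩ := hp
  have : ExpChar κ p := ExpChar.prime Fact.out
  have : ExpChar R.K p := expChar_of_injective_ringHom x.i.injective p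
  have hH := x.pts.ker φ
  obtain ⟨G', hc, hG⟩ := exists_quotient hH (kerPts_injective x.injective φ)
  let l' : A₂ → R := fun c => nrm x.G (kerPts φ x.l) (x.l (Function.surjInv hφ c))
  have hl' : ∀ a, l' (φ a) = nrm x.G (kerPts φ x.l) (x.l a) := fun a =>
    nrm_eq_of_eq x.comm x.pts (Function.surjInv_eq hφ _)
  have pts : IsPts G' l' := by
    refine ⟨fun c => nrm_nilp hH (x.pts.nilp _), ?_, fun c d => ?_⟩
    · rw [← map_one φ, hl', x.pts.one, nrm_zero hH]
    · obtain ⟨a, rfl⟩ := hφ c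
      obtain ⟨b, rfl⟩ := hφ d
      rw [← map_mul, hl', hl', hl', fadd_quotient hH hG (x.pts.nilp a) (x.pts.nilp b), x.pts.mul]
  have inj : Function.Injective l' := by
    have h0 : ∀ c, l' c = 0 → c = 1 := by
      intro c hc
      obtain ⟨a, rfl⟩ := hφ c
      rw [hl', nrm, Finset.prod_eq_zero_iff] at hc
      obtain ⟨k, -, hk⟩ := hc
      have h1 : x.l (a * k) = 0 := by rw [x.pts.mul]; exact hk
      have h2 := x.injective (h1.trans x.pts.one.symm)
      have h3 := congrArg φ h2
      rwa [map_mul, (MonoidHom.mem_ker).1 k.2, mul_one, map_one] at h3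
    intro c d hcd
    have : l' (c * d⁻¹) = 0 := by
      rw [pts.mul, hcd, ← pts.mul, mul_inv_cancel, pts.one]
    exact mul_inv_eq_one.1 (h0 _ this)
  refine ⟨⟨G', hc, x.i.comp (iterateFrobenius κ p j), x.τ.map (iterateFrobenius R.K p j), ?_, l', pts,
    isLevel_of_injective pts inj⟩, hG, ?_, ?_, hl'⟩
  · rw [red_group hH hj hG]
    have hF : F.map (x.i.comp (iterateFrobenius κ p j)) =
        (F.map x.i).map (iterateFrobenius R.K p j) := by
      apply FormalGroup.ext
      ext m
      simp [iterateFrobenius_def]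
    rw [hF]
    exact x.τ_iso.map _
  · intro c
    rw [hj]; rfl
  · rw [red_qs hH, hj, red_tau]

theorem nrm_comp {ψ : A₁ →* A₂} {φ : A₂ →* A₃} (hψ : Function.Surjective ψ)
    {x : LevelObj F A₁ R} {y : LevelObj F A₂ R} (h : IsQuot ψ x y)
    {B : Type*} [CommRing B] [UniformSpace B] [IsUniformAddGroup B] [CompleteSpace B]
    [T2Space B] [IsTopologicalRing B] [IsLinearTopology B B] [Algebra R B] [ContinuousSMul R B]
    {b : B} (hb : IsTopologicallyNilpotent b) :
    nrm y.G (kerPts φ y.l) (nrm x.G (kerPts ψ x.l) b) = nrm x.G (kerPts (φ.comp ψ) x.l) b := by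
  classical
  have := x.comm
  have hH := x.pts.ker ψ
  let π : (φ.comp ψ).ker → φ.ker := fun a => ⟨ψ a, a.2⟩
  refine Eq.trans ?_ (Finset.prod_fiberwise Finset.univ π
    (fun d => fadd x.G b (algebraMap R B (kerPts (φ.comp ψ) x.l d))))
  refine Finset.prod_congr rfl fun c _ => ?_
  obtain ⟨a, ha⟩ := hψ c
  have hak : a ∈ (φ.comp ψ).ker := by
    rw [MonoidHom.mem_ker, MonoidHom.comp_apply, ha]; exact c.2
  have e1 : kerPts φ y.l c = nrm x.G (kerPts ψ x.l) (x.l a) := by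
    rw [← h.l, ha]; rfl
  have na := x.pts.nilp a
  have e2 : algebraMap R B (nrm x.G (kerPts ψ x.l) (x.l a)) =
      nrm x.G (kerPts ψ x.l) (algebraMap R B (x.l a)) :=
    map_nrm hH na (Algebra.ofId R B) (continuous_algebraMap R B)
  have naB : IsTopologicallyNilpotent (algebraMap R B (x.l a)) := algebraMap_nilp na
  rw [e1, e2, fadd_quotient hH h.group hb naB, nrm]
  refine Finset.prod_bij (fun k _ => (⟨a * k, by
      rw [MonoidHom.mem_ker, MonoidHom.comp_apply, map_mul, (MonoidHom.mem_ker).1 k.2, mul_one]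
      exact hak⟩ : (φ.comp ψ).ker)) ?_ ?_ ?_ ?_
  · intro k _
    simp only [Finset.mem_filter, Finset.mem_univ, true_and, π]
    apply Subtype.ext
    show ψ (a * k) = c
    rw [map_mul, (MonoidHom.mem_ker).1 k.2, mul_one, ha]
  · intro k _ k' _ hkk
    have := congrArg Subtype.val hkk
    exact Subtype.ext (mul_left_cancel this)
  · intro d hd
    have hd' : ψ d = c := congrArg Subtype.val (Finset.mem_filter.1 hd).2
    refine ⟨⟨a⁻¹ * d, ?_⟩, Finset.mem_univ _, ?_⟩
    · rw [MonoidHom.mem_ker, map_mul, map_inv, ha, hd', inv_mul_cancel]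
    · apply Subtype.ext; exact mul_inv_cancel_left a d
  · intro k _
    have e3 : kerPts (φ.comp ψ) x.l ⟨a * k, by
        rw [MonoidHom.mem_ker, MonoidHom.comp_apply, map_mul, (MonoidHom.mem_ker).1 k.2, mul_one]
        exact hak⟩ = fadd x.G (x.l a) (x.l k) := x.pts.mul a k
    have nk := x.pts.nilp (k : A₁)
    have nkB : IsTopologicallyNilpotent (algebraMap R B (x.l k)) := algebraMap_nilp nk
    rw [e3, algebraMap_fadd na nk, ← fadd_assoc x.G hb naB nkB]
    rfl

theorem card_ker_comp {ψ : A₁ →* A₂} {φ : A₂ →* A₃} (hψ : Function.Surjective ψ) :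
    Fintype.card (φ.comp ψ).ker = Fintype.card φ.ker * Fintype.card ψ.ker := by
  have h1 := (φ.comp ψ).ker.card_mul_index
  have h2 := φ.ker.card_mul_index
  have h3 := ψ.ker.card_mul_index
  have h4 : (φ.comp ψ).ker.index = φ.ker.index := Subgroup.index_comap_of_surjective φ.ker hψ
  have h5 : ψ.ker.index = Nat.card A₂ := by
    rw [Subgroup.index_ker, MonoidHom.range_eq_top.2 hψ, Subgroup.card_top]
  have h6 : φ.ker.index ≠ 0 := Subgroup.index_ne_zero_of_finite
  rw [h4, ← h3, h5, ← h2] at h1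
  simp only [Nat.card_eq_fintype_card] at h1
  refine Nat.eq_of_mul_eq_mul_right (Nat.pos_of_ne_zero h6) (h1.trans ?_)
  ring

theorem IsQuot.comp {ψ : A₁ →* A₂} {φ : A₂ →* A₃} (hψ : Function.Surjective ψ)
    {p : ℕ} [Fact p.Prime] [CharP κ p] (hpψ : ∃ j, Fintype.card ψ.ker = p ^ j)
    (hpφ : ∃ j, Fintype.card φ.ker = p ^ j)
    {x : LevelObj F A₁ R} {y : LevelObj F A₂ R} {z : LevelObj F A₃ R}
    (h : IsQuot ψ x y) (h' : IsQuot φ y z) : IsQuot (φ.comp ψ) x z := by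
  have : ExpChar κ p := ExpChar.prime Fact.out
  have : ExpChar R.K p := expChar_of_injective_ringHom x.i.injective p
  have hH := x.pts.ker ψ
  have n0 := X_nilp (R := R) (0 : Fin 2)
  have n1 := X_nilp (R := R) (1 : Fin 2)
  refine ⟨?_, fun c => ?_, ?_, fun a => ?_⟩
  · rw [← nrm_comp hψ h n0, ← nrm_comp hψ h n1, ← nrm_comp hψ h (fadd_nilp x.G n0 n1),
      fadd_quotient (y.pts.ker φ) h'.group (nrm_nilp hH n0) (nrm_nilp hH n1), h.group]
  · rw [h'.i, h.i, card_ker_comp hψ, pow_mul]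
  · obtain ⟨j, hj⟩ := hpψ
    obtain ⟨j', hj'⟩ := hpφ
    have h1 := h.τ
    have h2 := h'.τ
    rw [red_qs hH, hj, red_tau] at h1
    rw [red_qs (y.pts.ker φ), hj', red_tau] at h2
    rw [red_qs (x.pts.ker _), card_ker_comp hψ, hj, hj', ← pow_add, red_tau, h2, h1]
    ext m
    simp only [PowerSeries.coeff_map, iterateFrobenius_def, ← pow_mul, ← pow_add]
    rw [add_comm]
  · rw [MonoidHom.comp_apply, h'.l, h.l, nrm_comp hψ h (x.pts.nilp a)]

end QuotientObj

section Compat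
universe u
variable {κ : Type u} [Field κ]
variable {R S : TestRing.{u}} {F : FormalGroup κ} {A A' A₁ A₂ : Type*} [CommGroup A] [Fintype A]
  [CommGroup A'] [Fintype A'] [CommGroup A₁] [Fintype A₁] [CommGroup A₂] [Fintype A₂]

/-- Restriction of a level structure along an injection. -/
def LevelObj.restrict (ι : A →* A') (hι : Function.Injective ι) (x : LevelObj F A' R) :
    LevelObj F A R where
  G := x.G
  comm := x.comm
  i := x.i
  τ := x.τ
  τ_iso := x.τ_iso
  l := fun a => x.l (ι a)
  pts := ⟨fun a => x.pts.nilp _, by rw [map_one, x.pts.one],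
    fun a b => by rw [map_mul, x.pts.mul]⟩
  level := isLevel_of_injective ⟨fun a => x.pts.nilp _, by rw [map_one, x.pts.one],
    fun a b => by rw [map_mul, x.pts.mul]⟩ (x.injective.comp hι)

theorem nrm_congr {H H' : Type*} [CommGroup H] [Fintype H] [CommGroup H'] [Fintype H']
    {G : FormalGroup R} {h : H → R} {h' : H' → R} (e : H ≃ H') (he : ∀ a, h' (e a) = h a)
    {B : Type*} [CommRing B] [UniformSpace B] [Algebra R B] (b : B) :
    nrm G h b = nrm G h' b := by
  rw [nrm, nrm, ← Equiv.prod_comp e]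
  simp only [he]

theorem IsQuot.restrict {φ : A →* A₁} {φ' : A' →* A₂} {ι : A →* A'} (hι : Function.Injective ι)
    {ι' : A₁ →* A₂} (hι' : Function.Injective ι') (hc : ∀ a, φ' (ι a) = ι' (φ a))
    (hk : ∀ a' ∈ φ'.ker, ∃ a, ι a = a') {x : LevelObj F A' R} {y : LevelObj F A₂ R}
    (h : IsQuot φ' x y) : IsQuot φ (x.restrict ι hι) (y.restrict ι' hι') := by
  let e : φ.ker ≃ φ'.ker := Equiv.ofBijective
    (fun a => ⟨ι a, by rw [MonoidHom.mem_ker, hc, (MonoidHom.mem_ker).1 a.2, map_one]⟩) (by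
      refine ⟨fun a b hab => Subtype.ext (hι (congrArg Subtype.val hab)), fun a' => ?_⟩
      obtain ⟨a, ha⟩ := hk a' a'.2
      refine ⟨⟨a, ?_⟩, Subtype.ext ha⟩
      rw [MonoidHom.mem_ker]
      apply hι'
      rw [← hc, ha, map_one]; exact a'.2)
  have he : ∀ a, kerPts φ' x.l (e a) = kerPts φ (x.restrict ι hι).l a := fun a => rfl
  have hcard : Fintype.card φ.ker = Fintype.card φ'.ker := Fintype.card_congr e
  have hq : qs x.G (kerPts φ (x.restrict ι hι).l) = qs x.G (kerPts φ' x.l) := nrm_congr e he _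
  refine ⟨?_, fun c => ?_, ?_, fun a => ?_⟩
  · show fadd y.G (nrm x.G _ _) (nrm x.G _ _) = nrm x.G _ (fadd x.G _ _)
    rw [nrm_congr e he, nrm_congr e he, nrm_congr e he]; exact h.group
  · rw [hcard]; exact h.i c
  · rw [hcard]
    show y.τ.subst (PowerSeries.map R.res (qs x.G _)) = x.τ ^ _
    rw [hq]; exact h.τ
  · show y.l (ι' (φ a)) = nrm x.G _ (x.l (ι a))
    rw [nrm_congr e he, ← h.l, hc]

/-- `y` is the base change of `x` along the local homomorphism `g`. -/
structure IsPullback (g : R →+* S) [IsLocalHom g] (x : LevelObj F A R) (y : LevelObj F A S) :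
    Prop where
  G : y.G = x.G.map g
  i : ∀ c, y.i c = IsLocalRing.ResidueField.map g (x.i c)
  τ : y.τ = x.τ.map (IsLocalRing.ResidueField.map g)
  l : ∀ a, y.l a = g (x.l a)

theorem map_ev {R R' : Type*} [CommRing R] [UniformSpace R] [IsUniformAddGroup R]
    [IsTopologicalRing R] [CommRing R'] [UniformSpace R'] [IsUniformAddGroup R']
    [IsTopologicalRing R']
    {B : Type*} [CommRing B] [UniformSpace B] [IsUniformAddGroup B] [CompleteSpace B]
    [T2Space B] [IsTopologicalRing B] [IsLinearTopology B B] [Algebra R B] [ContinuousSMul R B]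
    {B' : Type*} [CommRing B'] [UniformSpace B'] [IsUniformAddGroup B'] [CompleteSpace B']
    [T2Space B'] [IsTopologicalRing B'] [IsLinearTopology B' B'] [Algebra R' B']
    [ContinuousSMul R' B'] {σ : Type*} (g : R →+* R') (ε : B →+* B') (hε : Continuous ε)
    (hg : ∀ r, ε (algebraMap R B r) = algebraMap R' B' (g r)) {a : σ → B} (ha : HasEval a)
    (f : MvPowerSeries σ R) : ε (ev a f) = ev (fun s => ε (a s)) (f.map g) := by
  have h1 := (hasSum_ev ha f).map ε hε
  have h2 := hasSum_ev (R := R') (ha.map (φ := ε) hε) (f.map g)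
  refine h1.unique ?_
  convert h2 using 1
  funext d
  simp only [Function.comp_apply, Algebra.smul_def, map_mul, hg, coeff_map, Finsupp.prod,
    map_prod, map_pow]

section
variable {g : R →+* S}

theorem continuous_local (g : R →+* S) [hg : IsLocalHom g] : Continuous g := by
  have h := (IsLocalRing.local_hom_TFAE g).out 0 2
  exact (WithIdeal.uniformContinuous_of_map_le (h.1 hg)).continuous

variable {B : Type*} [CommRing B] [UniformSpace B] [IsUniformAddGroup B] [CompleteSpace B]
    [T2Space B] [IsTopologicalRing B] [IsLinearTopology B B] [Algebra R B] [ContinuousSMul R B]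
    {B' : Type*} [CommRing B'] [UniformSpace B'] [IsUniformAddGroup B'] [CompleteSpace B']
    [T2Space B'] [IsTopologicalRing B'] [IsLinearTopology B' B'] [Algebra S B']
    [ContinuousSMul S B'] (ε : B →+* B')

theorem map_fadd' (hε : Continuous ε) (hg : ∀ r, ε (algebraMap R B r) = algebraMap S B' (g r)) (G : FormalGroup R) {a b : B} (ha : IsTopologicallyNilpotent a)
    (hb : IsTopologicallyNilpotent b) : ε (fadd G a b) = fadd (G.map g) (ε a) (ε b) := by
  rw [fadd, map_ev g ε hε hg (hasEval_pair ha hb), fadd]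
  congr 1; funext i
  obtain rfl | rfl : i = 0 ∨ i = 1 := by fin_cases i <;> simp
  · rfl
  · rfl

theorem map_nrm' (hε : Continuous ε) (hg : ∀ r, ε (algebraMap R B r) = algebraMap S B' (g r)) {H : Type*} [CommGroup H] [Fintype H] {G : FormalGroup R} {h : H → R}
    (hh : IsPts G h) {b : B} (hb : IsTopologicallyNilpotent b) :
    ε (nrm G h b) = nrm (G.map g) (fun a => g (h a)) (ε b) := by
  rw [nrm, map_prod, nrm]
  refine Finset.prod_congr rfl fun a _ => ?_
  have na : IsTopologicallyNilpotent (algebraMap R B (h a)) := algebraMap_nilp (hh.nilp a)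
  rw [map_fadd' ε hε hg G hb na, hg]

end

theorem continuous_mvmap {g : R →+* S} (hg : Continuous g) {σ : Type*} :
    Continuous (MvPowerSeries.map (σ := σ) g) := by
  refine continuous_pi fun d => ?_
  exact hg.comp (continuous_apply d)

theorem IsPullback.quot {φ : A₁ →* A₂} (hφ : Function.Surjective φ) {p : ℕ} [Fact p.Prime] [CharP κ p]
    (hp : ∃ j, Fintype.card φ.ker = p ^ j) {g : R →+* S} [IsLocalHom g]
    {x : LevelObj F A₁ R} {x' : LevelObj F A₁ S} {y : LevelObj F A₂ R} {y' : LevelObj F A₂ S}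
    (hx : IsPullback g x x') (hy : IsQuot φ x y) (hy' : IsQuot φ x' y') : IsPullback g y y' := by
  have := x.comm
  have := x'.comm
  obtain ⟨j, hj⟩ := hp
  have : ExpChar κ p := ExpChar.prime Fact.out
  have : ExpChar R.K p := expChar_of_injective_ringHom x.i.injective p
  have : ExpChar S.K p := expChar_of_injective_ringHom x'.i.injective p
  have hH := x.pts.ker φ
  have hH' := x'.pts.ker φ
  have hgc := continuous_local g
  have hl : (fun a => g (kerPts φ x.l a)) = kerPts φ x'.l := by
    funext a; exact (hx.l a).symm
  have n0 := X_nilp (R := R) (0 : Fin 2)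
  have n1 := X_nilp (R := R) (1 : Fin 2)
  have hc := continuous_mvmap (σ := Fin 2) hgc
  have hC : ∀ r, MvPowerSeries.map (σ := Fin 2) g (algebraMap R _ r) =
      algebraMap S (MvPowerSeries (Fin 2) S) (g r) := fun r => by
    rw [← c_eq_algebraMap, ← c_eq_algebraMap, map_C]
  refine ⟨?_, fun c => ?_, ?_, fun c => ?_⟩
  · refine quotient_unique hH' (kerPts_injective x'.injective φ) hy'.group ?_
    have nn0 := nrm_nilp hH n0
    have nn1 := nrm_nilp hH n1
    have n01 := fadd_nilp x.G n0 n1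
    have := congrArg (MvPowerSeries.map g) hy.group
    rw [map_fadd' _ hc hC y.G nn0 nn1, map_nrm' _ hc hC hH n0, map_nrm' _ hc hC hH n1,
      map_nrm' _ hc hC hH n01, map_fadd' _ hc hC x.G n0 n1, map_X, map_X, hl, ← hx.G] at this
    exact this
  · rw [hy'.i, hx.i, hy.i]
  · have h1 := hy.τ
    have h2 := hy'.τ
    rw [red_qs hH, hj, red_tau] at h1
    rw [red_qs hH', hj, red_tau] at h2
    rw [h2, h1, hx.τ]
    ext m
    simp [iterateFrobenius_def]
  · obtain ⟨a, rfl⟩ := hφ c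
    rw [hy'.l, hy.l, hx.l, map_nrm' (g := g) g hgc (fun _ => rfl) hH (x.pts.nilp a), hl, ← hx.G]

/-- The objects `x` and `y` are `⋆`-isomorphic. -/
structure IsStar (x y : LevelObj F A R) : Prop where
  i : x.i = y.i
  iso : ∃ δ : PowerSeries R, IsIso x.G y.G δ ∧ y.τ.subst (PowerSeries.map R.res δ) = x.τ ∧
    ∀ a, y.l a = ev (fun _ : Unit => x.l a) δ

theorem ev_at_zero (f : PowerSeries R) (hf : f.constantCoeff = 0) {B : Type*} [CommRing B]
    [UniformSpace B] [IsUniformAddGroup B] [CompleteSpace B]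
    [T2Space B] [IsTopologicalRing B] [IsLinearTopology B B] [Algebra R B] [ContinuousSMul R B] :
    ev (fun _ : Unit => (0 : B)) f = 0 := by
  obtain ⟨w, hw⟩ := PowerSeries.X_dvd_iff.2 hf
  have h0 : IsTopologicallyNilpotent (0 : B) := nilp_zero
  rw [hw, ev_mul (hasEval_of_finite fun _ => h0)]
  have : ev (fun _ : Unit => (0 : B)) (PowerSeries.X : PowerSeries R) = 0 := ev_X ()
  rw [this, zero_mul]

set_option maxHeartbeats 400000 in
theorem IsStar.quot {φ : A₁ →* A₂} (hφ : Function.Surjective φ) {p : ℕ} [Fact p.Prime] [CharP κ p]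
    (hp : ∃ j, Fintype.card φ.ker = p ^ j)
    {x x' : LevelObj F A₁ R} {y y' : LevelObj F A₂ R}
    (hx : IsStar x x') (hy : IsQuot φ x y) (hy' : IsQuot φ x' y') : IsStar y y' := by
  have := x.comm
  have := x'.comm
  obtain ⟨j, hj⟩ := hp
  have : ExpChar κ p := ExpChar.prime Fact.out
  have : ExpChar R.K p := expChar_of_injective_ringHom x.i.injective p
  have hH := x.pts.ker φ
  have hH' := x'.pts.ker φ
  obtain ⟨hi, δ, hδ, hτ, hl⟩ := hx
  have hS : PowerSeries.HasSubst δ := PowerSeries.HasSubst.of_constantCoeff_zero' hδ.const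
  have hGS : PowerSeries.HasSubst x.G.toPowerSeries :=
    PowerSeries.HasSubst.of_constantCoeff_zero x.G.zero_constantCoeff
  -- evaluation of a series in one variable
  have sub_ev : ∀ {σ : Type} [Finite σ] (f : PowerSeries R) (i : σ),
      sub1 f i = ev (fun _ : Unit => (X i : MvPowerSeries σ R)) f := fun f i => by
    rw [sub1, PowerSeries.subst_def, subst_eq_ev (PowerSeries.HasSubst.X i).const]
  have Dn : ∀ {σ : Type} [Finite σ] {b : MvPowerSeries σ R}, IsTopologicallyNilpotent b →
      IsTopologicallyNilpotent (ev (fun _ : Unit => b) δ) := fun hb =>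
    ev_nilp (fun _ => hb) hδ.const
  have homδ : fadd x'.G (ev (fun _ : Unit => (X 0 : MvPowerSeries (Fin 2) R)) δ)
      (ev (fun _ : Unit => (X 1 : MvPowerSeries (Fin 2) R)) δ) =
      ev (fun _ : Unit => x.G.toPowerSeries) δ := by
    have := hδ.hom
    rw [PowerSeries.subst_def, subst_eq_ev hGS.const, subst_eq_ev (sub1_hasSubst hδ.const)] at this
    rw [this, fadd]
    congr 1; funext i
    rw [sub_ev]
    obtain rfl | rfl : i = 0 ∨ i = 1 := by fin_cases i <;> simp
    · rfl
    · rfl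
  have D1 : ∀ {σ : Type} [Finite σ] {a b : MvPowerSeries σ R}, IsTopologicallyNilpotent a →
      IsTopologicallyNilpotent b → ev (fun _ : Unit => fadd x.G a b) δ =
        fadd x'.G (ev (fun _ : Unit => a) δ) (ev (fun _ : Unit => b) δ) := by
    intro σ _ a b ha hb
    have E := hasEval_pair ha hb
    have n0 := Dn (X_nilp (R := R) (0 : Fin 2))
    have n1 := Dn (X_nilp (R := R) (1 : Fin 2))
    have e0 : ∀ i : Fin 2, HasEval (fun _ : Unit => (X i : MvPowerSeries (Fin 2) R)) :=
      fun i => hasEval_of_finite fun _ => X_nilp i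
    have := congrArg (ev ![a, b]) homδ
    rw [ev_fadd x'.G E n0 n1, ev_ev (e0 0) E, ev_ev (e0 1) E, ev_ev hGS.const.hasEval E, ev_X,
      ev_X] at this
    exact this.symm
  have DC : ∀ {σ : Type} [Finite σ] (a : A₁), ev (fun _ : Unit => (C (x.l a) : MvPowerSeries σ R)) δ
      = C (x'.l a) := by
    intro σ _ a
    rw [hl, c_eq_algebraMap]
    exact (ev_comp (hasEval_of_finite fun _ => x.pts.nilp a)
      (Algebra.ofId R (MvPowerSeries σ R)) (continuous_algebraMap R _) δ).symm
  have nX := X_nilp (R := R) ()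
  have DX : ev (fun _ : Unit => (X () : MvPowerSeries Unit R)) δ = δ := ev_X_self δ
  have nδ : IsTopologicallyNilpotent (δ : MvPowerSeries Unit R) := by
    have := Dn nX
    rwa [DX] at this
  have hinv : Inv x.G (kerPts φ x.l) (nrm x'.G (kerPts φ x'.l) (δ : MvPowerSeries Unit R)) := by
    intro i a
    have nC := C_nilp (τ := Unit) (hH.nilp a)
    have nt := trans_nilp (τ := Unit) hH i a
    have E := upd_hasEval i nt
    have hu : upd i (fadd x.G (X i) (C (kerPts φ x.l a))) =
        fun _ : Unit => (fadd x.G (X ()) (C (kerPts φ x.l a)) : MvPowerSeries Unit R) := by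
      funext k; exact upd_same _ _
    have e1 : ev (fun _ : Unit => (C (kerPts φ x.l a) : MvPowerSeries Unit R)) δ =
      C (kerPts φ x'.l a) := DC a
    rw [ev_nrm hH' E nδ, hu, D1 nX nC, DX, e1, c_eq_algebraMap, nrm_translate hH' nδ a]
  obtain ⟨δ', hδ'⟩ := descent hH (kerPts_injective x.injective φ) hinv
  have EN : ∀ {σ : Type} [Finite σ], HasEval
      (fun i : σ => nrm x.G (kerPts φ x.l) (X i : MvPowerSeries σ R)) := fun {σ} _ =>
    hasEval_of_finite fun i => nrm_nilp hH (X_nilp i)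
  have D'gen : ∀ {B : Type u} [CommRing B] [UniformSpace B] [IsUniformAddGroup B] [CompleteSpace B]
      [T2Space B] [IsTopologicalRing B] [IsLinearTopology B B] [Algebra R B] [ContinuousSMul R B]
      {b : B}, IsTopologicallyNilpotent b →
      ev (fun _ : Unit => nrm x.G (kerPts φ x.l) b) δ' =
        nrm x'.G (kerPts φ x'.l) (ev (fun _ : Unit => b) δ) := by
    intro B _ _ _ _ _ _ _ _ _ b hb
    have E : HasEval (fun _ : Unit => b) := hasEval_of_finite fun _ => hb
    have := congrArg (ev (fun _ : Unit => b)) hδ'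
    rw [ev_ev EN E, ev_nrm hH' E nδ] at this
    rw [← this]
    congr 1; funext i
    rw [ev_nrm hH E (X_nilp i), ev_X]
  have nZ : IsTopologicallyNilpotent (0 : MvPowerSeries Unit R) := nilp_zero
  have const : PowerSeries.constantCoeff δ' = 0 := by
    have h1 := D'gen nZ
    rw [nrm_zero hH, ev_at_zero δ hδ.const, nrm_zero hH'] at h1
    have h2 := subst_zero_eq_C_constantCoeff (f := (δ' : MvPowerSeries Unit R)) (S := R) (τ := Unit)
    rw [Algebra.algebraMap_self, MvPowerSeries.map_id, RingHom.id_apply] at h2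
    have h2' := subst_eq_ev (τ := Unit) (HasSubst.zero (σ := Unit)) (δ' : MvPowerSeries Unit R)
    have h3 : (C (constantCoeff (δ' : MvPowerSeries Unit R)) : MvPowerSeries Unit R) = 0 :=
      h2.symm.trans (h2'.trans h1)
    have h4 := congrArg constantCoeff h3
    rw [constantCoeff_C, map_zero] at h4
    exact h4
  have red : PowerSeries.map R.res δ' =
      (PowerSeries.map R.res δ).map (iterateFrobenius R.K p j) := by
    rw [← red_tau (p := p)]
    have h1 := congrArg (MvPowerSeries.map R.res) hδ'
    have h2 : (fun i : Unit => nrm x.G (kerPts φ x.l) (X i : MvPowerSeries Unit R)) =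
        sub1 (qs x.G (kerPts φ x.l)) := by funext i; rw [sub1_qs hH]
    rw [red_nrm hH' nδ, h2, ← subst_eq_ev (sub1_hasSubst (qs_const hH)),
      map_subst (sub1_hasSubst (qs_const hH)), show Fintype.card φ.ker = p ^ j from hj] at h1
    refine Eq.trans ?_ h1
    rw [PowerSeries.subst_def]
    congr 1; funext i
    rw [sub1_map, red_qs hH, hj, sub1, PowerSeries.subst_pow (PowerSeries.HasSubst.X i),
      PowerSeries.subst_X (PowerSeries.HasSubst.X i)]
    rfl
  refine ⟨?_, δ', ⟨const, ?_, ?_⟩, ?_, ?_⟩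
  · ext c; rw [hy.i, hy'.i, hi]
  · have h1 := congrArg (PowerSeries.coeff 1) red
    rw [PowerSeries.coeff_map, PowerSeries.coeff_map, PowerSeries.coeff_map] at h1
    refine isUnit_of_map_unit R.res _ ?_
    rw [h1]
    exact (hδ.unit.map R.res).map _
  · have hGy : PowerSeries.HasSubst y.G.toPowerSeries :=
      PowerSeries.HasSubst.of_constantCoeff_zero y.G.zero_constantCoeff
    rw [PowerSeries.subst_def, subst_eq_ev hGy.const, subst_eq_ev (sub1_hasSubst const)]
    apply ev_nrm_X_injective hH (kerPts_injective x.injective φ)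
    show ev (fun i : Fin 2 => nrm x.G (kerPts φ x.l) (X i : MvPowerSeries (Fin 2) R)) _ =
      ev (fun i : Fin 2 => nrm x.G (kerPts φ x.l) (X i : MvPowerSeries (Fin 2) R)) _
    have E2 := EN (σ := Fin 2)
    have n0 := X_nilp (R := R) (0 : Fin 2)
    have n1 := X_nilp (R := R) (1 : Fin 2)
    have n01 := fadd_nilp x.G n0 n1
    have hS' := sub1_hasSubst (τ := Fin 2) const
    rw [ev_ev hGy.const.hasEval E2, ev_ev hS'.hasEval E2]
    have e1 : (fun _ : Unit => ev (fun i : Fin 2 =>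
        nrm x.G (kerPts φ x.l) (X i : MvPowerSeries (Fin 2) R)) y.G.toPowerSeries) =
        fun _ : Unit => nrm x.G (kerPts φ x.l) (fadd x.G (X 0) (X 1)) := by
      funext _
      rw [← hy.group, fadd]
      congr 1; funext i
      obtain rfl | rfl : i = 0 ∨ i = 1 := by fin_cases i <;> simp
      · rfl
      · rfl
    have e2 : (fun s : Fin 2 => ev (fun i : Fin 2 =>
        nrm x.G (kerPts φ x.l) (X i : MvPowerSeries (Fin 2) R)) (sub1 δ' s)) =
        ![nrm x'.G (kerPts φ x'.l) (ev (fun _ : Unit => (X 0 : MvPowerSeries (Fin 2) R)) δ),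
          nrm x'.G (kerPts φ x'.l) (ev (fun _ : Unit => (X 1 : MvPowerSeries (Fin 2) R)) δ)] := by
      funext s
      have e3 : HasEval (fun _ : Unit => (X s : MvPowerSeries (Fin 2) R)) :=
        hasEval_of_finite fun _ => X_nilp s
      have nXs := X_nilp (R := R) s
      have k1 : ev (fun _ : Unit => nrm x.G (kerPts φ x.l) (X s : MvPowerSeries (Fin 2) R)) δ' =
        nrm x'.G (kerPts φ x'.l) (ev (fun _ : Unit => (X s : MvPowerSeries (Fin 2) R)) δ) :=
        D'gen nXs
      rw [sub_ev, ev_ev e3 E2, ev_X, k1]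
      obtain rfl | rfl : s = 0 ∨ s = 1 := by fin_cases s <;> simp
      · rfl
      · rfl
    have k2 : ev (fun _ : Unit => nrm x.G (kerPts φ x.l)
        (fadd x.G (X 0) (X 1) : MvPowerSeries (Fin 2) R)) δ' = nrm x'.G (kerPts φ x'.l)
        (ev (fun _ : Unit => (fadd x.G (X 0) (X 1) : MvPowerSeries (Fin 2) R)) δ) := D'gen n01
    rw [e1, e2, k2, D1 n0 n1]
    have d0 := Dn n0
    have d1 := Dn n1
    rw [← fadd_quotient hH' hy'.group d0 d1, fadd]
  · have h1 := hy.τ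
    have h2 := hy'.τ
    rw [red_qs hH, hj, red_tau] at h1
    rw [red_qs hH', hj, red_tau] at h2
    have hSr : PowerSeries.HasSubst (PowerSeries.map R.res δ) :=
      PowerSeries.HasSubst.of_constantCoeff_zero' (map_const _ hδ.const)
    rw [h2, red, h1, ← hτ]
    exact (PowerSeries.map_subst hSr (h := iterateFrobenius R.K p j) x'.τ).symm
  · intro c
    obtain ⟨a, rfl⟩ := hφ c
    rw [hy'.l, hy.l, D'gen (x.pts.nilp a), hl]

end Compat

section Lattice
variable (p : ℕ) [hp : Fact p.Prime] (n : ℕ)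

/-- The lattice `ℤ_p^n`, written multiplicatively. -/
abbrev Lat : Type := Multiplicative (Fin n → ℤ_[p])

/-- The Pontryagin dual `T ≅ (ℚ_p/ℤ_p)^n` of the lattice. -/
abbrev Tor : Type := PontryaginDual (Lat p n)

variable {p n}

/-- The character `x ↦ exp (2 π i x / p ^ k)` of `ℤ_p`. -/
def rt (k : ℕ) (x : ℤ_[p]) : Circle := ZMod.toCircle (PadicInt.toZModPow k x)

theorem rt_add (k : ℕ) (x y : ℤ_[p]) : rt k (x + y) = rt k x * rt k y := by
  rw [rt, map_add, AddChar.map_add_eq_mul]; rfl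

theorem rt_zero (k : ℕ) : rt k (0 : ℤ_[p]) = 1 := by
  rw [rt, map_zero, AddChar.map_zero_eq_one]

theorem rt_eq_one {k : ℕ} {x : ℤ_[p]} : rt k x = 1 ↔ x ∈ Ideal.span {(p : ℤ_[p]) ^ k} := by
  rw [← PadicInt.ker_toZModPow, RingHom.mem_ker, rt]
  refine ⟨fun h => ZMod.injective_toCircle ?_, fun h => by rw [h, AddChar.map_zero_eq_one]⟩
  rw [h, AddChar.map_zero_eq_one]

theorem rt_eq_iff {k : ℕ} {x y : ℤ_[p]} : rt k x = rt k y ↔ x - y ∈ Ideal.span {(p : ℤ_[p]) ^ k} := by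
  rw [← rt_eq_one]
  have h : rt k x = rt k (x - y) * rt k y := by rw [← rt_add, sub_add_cancel]
  rw [h]
  exact ⟨fun h => by simpa using h, fun h => by rw [h, one_mul]⟩

theorem rt_nsmul (k m : ℕ) (x : ℤ_[p]) : rt k ((m : ℤ_[p]) * x) = rt k x ^ m := by
  induction m with
  | zero => simp [rt_zero]
  | succ m ih => rw [Nat.cast_succ, add_mul, one_mul, rt_add, ih, pow_succ]

theorem rt_sum {ι : Type*} (k : ℕ) (S : Finset ι) (f : ι → ℤ_[p]) :
    rt k (∑ i ∈ S, f i) = ∏ i ∈ S, rt k (f i) := by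
  classical
  induction S using Finset.induction_on with
  | empty => simp [rt_zero]
  | insert a S ha ih => rw [Finset.sum_insert ha, Finset.prod_insert ha, rt_add, ih]

theorem rt_natCast (k m : ℕ) :
    (rt k (m : ℤ_[p]) : ℂ) = Complex.exp (2 * Real.pi * Complex.I * m / (p ^ k : ℕ)) := by
  rw [rt, map_natCast, ZMod.toCircle_natCast]

theorem rt_pow (k : ℕ) (x : ℤ_[p]) : rt (k + 1) x ^ p = rt k x := by
  have h0 : (p : ℂ) ≠ 0 := by exact_mod_cast hp.out.ne_zero
  have hN : ∀ m : ℕ, rt (k + 1) (m : ℤ_[p]) ^ p = rt k (m : ℤ_[p]) := by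
    intro m
    apply Circle.ext
    rw [Circle.coe_pow, rt_natCast, rt_natCast, ← Complex.exp_nat_mul]
    congr 1
    push_cast
    field_simp
    ring
  have h1 : x - ((PadicInt.toZModPow (k + 1) x).val : ℤ_[p]) ∈ Ideal.span {(p : ℤ_[p]) ^ (k + 1)} := by
    rw [← PadicInt.ker_toZModPow, RingHom.mem_ker, map_sub, map_natCast, ZMod.natCast_zmod_val,
      sub_self]
  have h2 : x - ((PadicInt.toZModPow (k + 1) x).val : ℤ_[p]) ∈ Ideal.span {(p : ℤ_[p]) ^ k} :=
    Ideal.span_singleton_le_span_singleton.2 (pow_dvd_pow _ (Nat.le_succ k)) h1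
  rw [rt_eq_iff.2 h1, rt_eq_iff.2 h2, hN]

theorem exists_rt {k : ℕ} {z : Circle} (hz : z ^ (p ^ k) = 1) : ∃ x : ℤ_[p], rt k x = z := by
  obtain ⟨j, hj⟩ := (bijective_rootsOfUnityAddChar (p ^ k)).2
    ⟨toUnits z, by rw [mem_rootsOfUnity]; ext; simp [hz]⟩
  refine ⟨(j.val : ℤ_[p]), ?_⟩
  rw [rt, map_natCast, ZMod.natCast_zmod_val]
  have := congrArg (fun u => (u : Circleˣ).val) (congrArg Subtype.val hj)
  simpa using this

theorem continuous_rt (k : ℕ) : Continuous (rt k : ℤ_[p] → Circle) := by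
  refine continuous_iff_continuousAt.2 fun x => ?_
  have h : (fun y => rt k y) =ᶠ[𝓝 x] fun _ => rt k x := by
    have hpos : (0 : ℝ) < (p : ℝ) ^ (-k : ℤ) := zpow_pos (mod_cast hp.out.pos) _
    filter_upwards [Metric.ball_mem_nhds x hpos] with y hy
    rw [rt_eq_iff, ← PadicInt.norm_le_pow_iff_mem_span_pow]
    rw [Metric.mem_ball, dist_eq_norm] at hy
    exact hy.le
  exact (continuousAt_const (y := rt k x)).congr h.symm

/-- Evaluation of characters. -/
def pdEval (v : Lat p n) : Tor p n →* Circle where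
  toFun χ := χ v
  map_one' := rfl
  map_mul' _ _ := rfl

theorem pd_pow (χ : Tor p n) (m : ℕ) (v : Lat p n) : (χ ^ m) v = χ v ^ m := map_pow (pdEval v) χ m

/-- The character `v ↦ exp (2 π i ⟨c, v⟩ / p ^ k)`. -/
def chr (k : ℕ) (c : Fin n → ℤ_[p]) : Tor p n where
  toFun v := rt k (∑ i, c i * v.toAdd i)
  map_one' := by simp [rt_zero]
  map_mul' v w := by
    rw [← rt_add]
    congr 1
    rw [← Finset.sum_add_distrib]
    exact Finset.sum_congr rfl fun i _ => by rw [toAdd_mul, Pi.add_apply, mul_add]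
  continuous_toFun := by
    refine (continuous_rt k).comp (continuous_finsetSum _ fun i _ => ?_)
    exact continuous_const.mul ((continuous_apply i).comp continuous_toAdd)

theorem chr_apply (k : ℕ) (c : Fin n → ℤ_[p]) (v : Lat p n) :
    chr k c v = rt k (∑ i, c i * v.toAdd i) := rfl

theorem chr_pow (k : ℕ) (c : Fin n → ℤ_[p]) : chr (k + 1) c ^ p = chr k c := by
  apply PontryaginDual.ext
  intro v
  rw [pd_pow, chr_apply, rt_pow]; rfl

theorem chr_torsion (k : ℕ) (c : Fin n → ℤ_[p]) : chr k c ^ (p ^ k) = 1 := by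
  induction k with
  | zero =>
    apply PontryaginDual.ext
    intro v
    rw [pd_pow, chr_apply, pow_zero, pow_one, PontryaginDual.one_apply, rt_eq_one]
    simp
  | succ k ih => rw [pow_succ', pow_mul, chr_pow, ih]

theorem exists_torsion (χ : Tor p n) : ∃ k, χ ^ (p ^ k) = 1 := by
  have hU : χ ⁻¹' (Circle.centeredArc (Real.pi / 2)) ∈ 𝓝 (1 : Lat p n) := by
    refine (map_continuous χ).continuousAt.preimage_mem_nhds ?_
    rw [map_one]
    exact (Circle.isOpen_centeredArc _).mem_nhds (by
      rw [Circle.mem_centeredArc (by linarith [Real.pi_pos])]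
      simp [Real.pi_pos])
  obtain ⟨ε, hε, hB⟩ := Metric.mem_nhds_iff.1
    (show (fun v : Fin n → ℤ_[p] => χ (Multiplicative.ofAdd v)) ⁻¹'
      (Circle.centeredArc (Real.pi / 2)) ∈ 𝓝 (0 : Fin n → ℤ_[p]) from hU)
  obtain ⟨k, hk⟩ := PadicInt.exists_pow_neg_lt p hε
  refine ⟨k, ?_⟩
  apply PontryaginDual.ext
  intro v
  refine Circle.eq_one_of_forall_pow_mem_centeredArc_pi_div_two fun m _ => ?_
  have h1 : (m * p ^ k) • v.toAdd ∈ Metric.ball (0 : Fin n → ℤ_[p]) ε := by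
    rw [mem_ball_zero_iff]
    refine lt_of_le_of_lt ?_ hk
    refine (pi_norm_le_iff_of_nonneg (by positivity)).2 fun i => ?_
    rw [PadicInt.norm_le_pow_iff_mem_span_pow, Ideal.mem_span_singleton, Pi.smul_apply, nsmul_eq_mul]
    push_cast
    exact Dvd.intro_left (m * v.toAdd i) (by ring)
  have h2 := hB h1
  have h3 : (χ ^ (p ^ k)) v ^ m = χ (Multiplicative.ofAdd ((m * p ^ k) • v.toAdd)) := by
    rw [pd_pow, ofAdd_nsmul, map_pow, ← pow_mul, mul_comm, ofAdd_toAdd]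
  rw [h3]
  exact h2

theorem exists_chr {k : ℕ} {χ : Tor p n} (h : χ ^ (p ^ k) = 1) : ∃ c, χ = chr k c := by
  classical
  let b : Fin n → Lat p n := fun i => Multiplicative.ofAdd (Pi.single i 1)
  have h1 : ∀ v, χ v ^ (p ^ k) = 1 := fun v => by rw [← pd_pow, h]; rfl
  choose c hc using fun i => exists_rt (h1 (b i))
  refine ⟨c, PontryaginDual.ext fun v => ?_⟩
  have key : ∀ x : ℤ_[p], ∃ (m : ℕ) (y : ℤ_[p]), x = m + p ^ k * y := by
    intro x
    have h1 : x - ((PadicInt.toZModPow k x).val : ℤ_[p]) ∈ Ideal.span {(p : ℤ_[p]) ^ k} := by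
      rw [← PadicInt.ker_toZModPow, RingHom.mem_ker, map_sub, map_natCast, ZMod.natCast_zmod_val,
        sub_self]
    obtain ⟨y, hy⟩ := Ideal.mem_span_singleton.1 h1
    exact ⟨_, y, by rw [← hy]; ring⟩
  choose m y hmy using fun i => key (v.toAdd i)
  have hv : v = (∏ i, b i ^ m i) * (Multiplicative.ofAdd y) ^ (p ^ k) := by
    apply Multiplicative.toAdd.injective
    rw [toAdd_mul, toAdd_prod, toAdd_pow]
    funext j
    rw [Pi.add_apply, Finset.sum_apply, hmy j]
    simp only [toAdd_pow, b, toAdd_ofAdd, Pi.smul_apply, nsmul_eq_mul]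
    congr 1
    · rw [Finset.sum_eq_single j]
      · simp
      · intro i _ hij; simp [Pi.single_eq_of_ne hij.symm]
      · simp
    · push_cast; rfl
  conv_lhs => rw [hv]
  rw [map_mul, map_pow, h1, mul_one, map_prod, chr_apply, rt_sum]
  refine Finset.prod_congr rfl fun i _ => ?_
  rw [map_pow, ← hc, ← rt_nsmul, rt_eq_iff, hmy i, Ideal.mem_span_singleton]
  exact ⟨-(c i * y i), by ring⟩

theorem chr_eq {k : ℕ} {c d : Fin n → ℤ_[p]}
    (h : ∀ i, c i - d i ∈ Ideal.span {(p : ℤ_[p]) ^ k}) : chr k c = chr k d := by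
  apply PontryaginDual.ext
  intro v
  rw [chr_apply, chr_apply, rt_eq_iff, ← Finset.sum_sub_distrib]
  refine Ideal.sum_mem _ fun i _ => ?_
  rw [← sub_mul]
  exact Ideal.mul_mem_right _ _ (h i)

theorem finite_torsion (k : ℕ) : {χ : Tor p n | χ ^ (p ^ k) = 1}.Finite := by
  refine (Set.finite_range fun c : Fin n → ZMod (p ^ k) =>
    (chr k fun i => ((c i).val : ℤ_[p]) : Tor p n)).subset ?_
  intro χ hχ
  obtain ⟨c, rfl⟩ := exists_chr hχ
  refine ⟨fun i => PadicInt.toZModPow k (c i), chr_eq fun i => ?_⟩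
  rw [← PadicInt.ker_toZModPow, RingHom.mem_ker, map_sub, map_natCast, ZMod.natCast_zmod_val,
    sub_self]

theorem exists_root (k : ℕ) (χ : Tor p n) : ∃ ψ : Tor p n, ψ ^ (p ^ k) = χ := by
  induction k with
  | zero => exact ⟨χ, by simp⟩
  | succ k ih =>
    obtain ⟨ψ, rfl⟩ := ih
    obtain ⟨j, hj⟩ := exists_torsion ψ
    obtain ⟨c, rfl⟩ := exists_chr hj
    exact ⟨chr (j + 1) c, by rw [pow_succ', pow_mul, chr_pow]⟩

theorem card_finite_subgroup (H : Subgroup (Tor p n)) [Finite H] : ∃ j, Nat.card H = p ^ j := by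
  refine IsPGroup.iff_card.1 fun χ => ?_
  obtain ⟨k, hk⟩ := exists_torsion χ.1
  exact ⟨k, Subtype.ext hk⟩

theorem card_ker_comp' {T : Type*} [CommGroup T] (f g : T →* T) :
    Nat.card (f.comp g).ker = Nat.card g.ker * Nat.card ↥(f.ker ⊓ g.range) := by
  let r : (f.comp g).ker →* T := g.domRestrict (f.comp g).ker
  have h := r.ker.card_mul_index
  have h1 : r.ker = g.ker.subgroupOf (f.comp g).ker := rfl
  have h2 : r.range = f.ker ⊓ g.range := by
    rw [MonoidHom.domRestrict_range, ← MonoidHom.comap_ker, Subgroup.map_comap_eq, inf_comm]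
  have hle : g.ker ≤ (f.comp g).ker := fun x hx => by
    rw [MonoidHom.mem_ker, MonoidHom.comp_apply, (MonoidHom.mem_ker).1 hx, map_one]
  rw [Subgroup.index_ker, h2, h1, Nat.card_congr (Subgroup.subgroupOfEquivOfLe hle).toEquiv] at h
  exact h.symm

/-- An endomorphism of `T` with finite kernel is surjective. -/
theorem isog_surjective (φ : Tor p n →* Tor p n) (h : (φ.ker : Set (Tor p n)).Finite) :
    Function.Surjective φ := by
  intro χ
  obtain ⟨k, hk⟩ := exists_torsion χ
  let π : Tor p n →* Tor p n := powMonoidHom (p ^ k)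
  have hπ : Function.Surjective π := exists_root k
  have : Finite φ.ker := h
  have hf : Finite π.ker := finite_torsion k
  have hc : φ.comp π = π.comp φ := by ext1 ψ; exact map_pow φ ψ _
  have h1 := card_ker_comp' φ π
  have h2 := card_ker_comp' π φ
  rw [hc, MonoidHom.range_eq_top.2 hπ, inf_top_eq, h2, mul_comm] at h1
  have h3 : Nat.card ↥(π.ker ⊓ φ.range) = Nat.card π.ker :=
    Nat.eq_of_mul_eq_mul_right Nat.card_pos h1
  have h4 : π.ker ⊓ φ.range = π.ker := Subgroup.eq_of_le_of_card_ge inf_le_left h3.ge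
  have h5 : χ ∈ π.ker ⊓ φ.range := by rw [h4]; exact hk
  exact h5.2

theorem exists_limit (a : ℕ → ℤ_[p]) (ha : ∀ k, a (k + 1) - a k ∈ Ideal.span {(p : ℤ_[p]) ^ k}) :
    ∃ x, ∀ k, x - a k ∈ Ideal.span {(p : ℤ_[p]) ^ k} := by
  have hm : ∀ {k m}, k ≤ m → a k ≡ a m [SMOD (IsLocalRing.maximalIdeal ℤ_[p] ^ k • ⊤ : Submodule ℤ_[p] ℤ_[p])] := by
    intro k m hkm
    rw [SModEq.sub_mem, smul_eq_mul, Ideal.mul_top, PadicInt.maximalIdeal_eq_span_p,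
      Ideal.span_singleton_pow]
    induction m, hkm using Nat.le_induction with
    | base => simp
    | succ m hm ih =>
      have h1 := Ideal.span_singleton_le_span_singleton.2 (pow_dvd_pow (p : ℤ_[p]) hm) (ha m)
      have := Ideal.sub_mem _ ih h1
      convert this using 1
      ring
  obtain ⟨x, hx⟩ := IsPrecomplete.prec (I := IsLocalRing.maximalIdeal ℤ_[p]) inferInstance (f := a) hm
  refine ⟨x, fun k => ?_⟩
  have := hx k
  rw [SModEq.sub_mem, smul_eq_mul, Ideal.mul_top, PadicInt.maximalIdeal_eq_span_p,
      Ideal.span_singleton_pow] at this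
  have := neg_mem this
  rwa [neg_sub] at this

/-- The Pontryagin dual of an endomorphism of `T`. -/
theorem exists_dual (φ : Tor p n →* Tor p n) :
    ∃ f : Lat p n →* Lat p n, Continuous f ∧ ∀ χ v, χ (f v) = φ χ v := by
  classical
  have h1 : ∀ k i, ∃ c, φ (chr k (Pi.single i 1)) = chr k c := by
    intro k i
    refine exists_chr ?_
    rw [← map_pow, chr_torsion, map_one]
  choose c hc using h1
  have h2 : ∀ i j, ∃ x, ∀ k, x - c k i j ∈ Ideal.span {(p : ℤ_[p]) ^ k} := by
    intro i j
    refine exists_limit _ fun k => ?_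
    have h3 : chr k (c (k + 1) i) = chr k (c k i) := by
      rw [← chr_pow, ← hc, ← map_pow, chr_pow, hc]
    have h4 := DFunLike.congr_fun h3 (Multiplicative.ofAdd (Pi.single j 1))
    rw [chr_apply, chr_apply, rt_eq_iff] at h4
    simpa [Pi.single_apply] using h4
  choose M hM using h2
  let f : Lat p n →* Lat p n := AddMonoidHom.toMultiplicative
    { toFun := fun v i => ∑ j, M i j * v j
      map_zero' := by funext i; simp
      map_add' := fun v w => by funext i; simp [mul_add, Finset.sum_add_distrib] }
  have hf : ∀ v i, (f v).toAdd i = ∑ j, M i j * v.toAdd j := fun v i => rfl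
  refine ⟨f, ?_, fun χ v => ?_⟩
  · have hc : Continuous (fun v : Fin n → ℤ_[p] => fun i => ∑ j, M i j * v j) :=
      continuous_pi fun i => continuous_finsetSum _ fun j _ =>
        continuous_const.mul (continuous_apply j)
    exact continuous_ofAdd.comp (hc.comp continuous_toAdd)
  · obtain ⟨k, hk⟩ := exists_torsion χ
    obtain ⟨d, rfl⟩ := exists_chr hk
    let m : Fin n → ℕ := fun i => (PadicInt.toZModPow k (d i)).val
    have hd : (chr k d : Tor p n) = ∏ i, (chr k (Pi.single i 1) : Tor p n) ^ m i := by
      have h3 : (chr k d : Tor p n) = chr k (fun i => (m i : ℤ_[p])) := chr_eq fun i => by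
        rw [← PadicInt.ker_toZModPow, RingHom.mem_ker, map_sub, map_natCast, ZMod.natCast_zmod_val,
          sub_self]
      rw [h3]
      refine PontryaginDual.ext fun v => ?_
      have h4 := map_prod (pdEval v) (fun i => (chr k (Pi.single i 1) : Tor p n) ^ m i) Finset.univ
      refine Eq.trans ?_ h4.symm
      rw [chr_apply, rt_sum]
      refine Finset.prod_congr rfl fun i _ => ?_
      rw [rt_nsmul, map_pow]
      congr 1
      show _ = chr k (Pi.single i 1) v
      rw [chr_apply]
      simp [Pi.single_apply]
    have hb : ∀ i, (chr k (Pi.single i 1) : Tor p n) (f v) = φ (chr k (Pi.single i 1)) v := by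
      intro i
      rw [hc, chr_apply, chr_apply, rt_eq_iff]
      simp only [Pi.single_apply, ite_mul, one_mul, zero_mul, Finset.sum_ite_eq', Finset.mem_univ,
        if_true, hf]
      rw [← Finset.sum_sub_distrib]
      refine Ideal.sum_mem _ fun j _ => ?_
      rw [← sub_mul]
      exact Ideal.mul_mem_right _ _ (hM i j k)
    have h5 : ∀ w : Lat p n, ∀ S : Tor p n →* Tor p n, S (chr k d) w =
        ∏ i, (S (chr k (Pi.single i 1)) w) ^ m i := by
      intro w S
      have h4 := map_prod ((pdEval w).comp S) (fun i => (chr k (Pi.single i 1) : Tor p n) ^ m i)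
        Finset.univ
      rw [hd]
      refine h4.trans (Finset.prod_congr rfl fun i _ => ?_)
      rw [map_pow]; rfl
    rw [h5 v φ, ← Finset.prod_congr rfl fun i _ => congrArg (· ^ m i) (hb i)]
    exact h5 (f v) (MonoidHom.id _)

end Lattice
section Trivial
universe u
variable {κ : Type u} [Field κ]
variable {R : TestRing.{u}} {F : FormalGroup κ} {A : Type*} [CommGroup A] [Fintype A]

theorem IsQuot.refl {φ : A →* A} (hφ : ∀ a, φ a = a) (x : LevelObj F A R) : IsQuot φ x x := by
  have hk : ∀ a : φ.ker, a = 1 := fun a => Subtype.ext ((hφ a.1).symm.trans a.2)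
  have hn : ∀ {B : Type u} [CommRing B] [UniformSpace B] [IsUniformAddGroup B] [CompleteSpace B]
      [T2Space B] [IsTopologicalRing B] [IsLinearTopology B B] [Algebra R B] [ContinuousSMul R B]
      {b : B}, IsTopologicallyNilpotent b → nrm x.G (kerPts φ x.l) b = b := by
    intro B _ _ _ _ _ _ _ _ _ b hb
    have h1 : kerPts φ x.l 1 = 0 := x.pts.one
    rw [nrm, Fintype.prod_eq_single 1 (fun a ha => absurd (hk a) ha), h1, map_zero, fadd_zero _ hb]
  have hc : Fintype.card φ.ker = 1 := Fintype.card_eq_one_iff.2 ⟨1, hk⟩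
  have n0 := X_nilp (R := R) (0 : Fin 2)
  have n1 := X_nilp (R := R) (1 : Fin 2)
  refine ⟨?_, fun c => by rw [hc, pow_one], ?_, fun a => ?_⟩
  · rw [hn n0, hn n1, hn (fadd_nilp x.G n0 n1)]
  · rw [red_qs (x.pts.ker φ), hc, pow_one, pow_one, PowerSeries.X_subst]
  · rw [hφ, hn (x.pts.nilp a)]

end Trivial

section Isogeny
universe u
variable (p : ℕ) [hp : Fact p.Prime] (n : ℕ)

/-- The monoid of endomorphisms of `T` with finite kernel. -/
def isogenies : Submonoid (Monoid.End (Tor p n)) where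
  carrier := {φ | ((MonoidHom.ker φ : Subgroup (Tor p n)) : Set (Tor p n)).Finite}
  one_mem' := by
    refine (Set.finite_singleton (1 : Tor p n)).subset fun χ hχ => ?_
    exact hχ
  mul_mem' := by
    intro φ ψ hφ hψ
    have h1 : Finite (MonoidHom.ker ψ) := hψ
    have h2 : Finite ↥(MonoidHom.ker φ ⊓ MonoidHom.range ψ) :=
      Set.Finite.subset hφ (fun _ h => h.1)
    have h3 := card_ker_comp' φ ψ
    have h4 : Nat.card ↥(MonoidHom.ker (MonoidHom.comp φ ψ)) ≠ 0 := by
      rw [h3]; exact mul_ne_zero Nat.card_pos.ne' Nat.card_pos.ne'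
    exact (Nat.finite_of_card_ne_zero h4 : Finite ↥(MonoidHom.ker (MonoidHom.comp φ ψ)))

/-- An isogeny: an endomorphism of `T` with finite kernel. -/
def Isog : Type := isogenies p n

instance : Monoid (Isog p n) := inferInstanceAs (Monoid (isogenies p n))

/-- The finite subgroups of `T`. -/
def FinSub : Type := {A : Subgroup (Tor p n) // (A : Set (Tor p n)).Finite}

variable {p n}

/-- An isogeny as a homomorphism. -/
def Isog.hom (φ : Isog p n) : Tor p n →* Tor p n := φ.1

theorem Isog.surjective (φ : Isog p n) : Function.Surjective φ.hom := isog_surjective φ.hom φ.2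

/-- The kernel of an isogeny. -/
def Isog.ker (φ : Isog p n) : FinSub p n := ⟨φ.hom.ker, φ.2⟩

/-- An automorphism of `T` as an isogeny. -/
def Isog.ofAut (γ : MulAut (Tor p n)) : Isog p n :=
  ⟨γ.toMonoidHom, by
    refine (Set.finite_singleton (1 : Tor p n)).subset fun χ hχ => ?_
    exact (MulEquiv.map_eq_one_iff γ).1 hχ⟩

/-- The Pontryagin dual `φ^* : L → L` of `φ : T → T`. -/
def Isog.dual (φ : Isog p n) : Lat p n →* Lat p n := (exists_dual φ.hom).choose

theorem Isog.continuous_dual (φ : Isog p n) : Continuous φ.dual :=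
  (exists_dual φ.hom).choose_spec.1

theorem Isog.dual_spec (φ : Isog p n) (χ : Tor p n) (v : Lat p n) : χ (φ.dual v) = φ.hom χ v :=
  (exists_dual φ.hom).choose_spec.2 χ v

instance : PartialOrder (FinSub p n) := Subtype.partialOrder _

instance (A : FinSub p n) : Finite A.1 := A.2

instance (A : FinSub p n) : Fintype A.1 := Fintype.ofFinite _

instance : Nonempty (FinSub p n) := ⟨⟨⊥, Set.finite_singleton _⟩⟩

instance : IsDirectedOrder (FinSub p n) where
  directed A B := by
    refine ⟨⟨A.1 ⊔ B.1, ?_⟩, (le_sup_left : A.1 ≤ A.1 ⊔ B.1), (le_sup_right : B.1 ≤ A.1 ⊔ B.1)⟩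
    rw [Subgroup.mul_normal A.1 B.1]
    exact A.2.mul B.2

/-- The inverse image of a finite subgroup under an isogeny. -/
def FinSub.comap (φ : Isog p n) (A : FinSub p n) : FinSub p n :=
  ⟨A.1.comap φ.hom, by
    have h1 : Finite φ.hom.ker := φ.2
    let r : ↥(A.1.comap φ.hom) →* Tor p n := φ.hom.domRestrict (A.1.comap φ.hom)
    have h2 : r.ker = φ.hom.ker.subgroupOf (A.1.comap φ.hom) := rfl
    have h3 : Finite r.ker := by
      rw [h2]
      exact Finite.of_injective (β := φ.hom.ker) (fun x => ⟨x.1.1, x.2⟩)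
        fun x y h => Subtype.ext (Subtype.ext (congrArg (fun z => z.1) h))
    have h4 : Finite r.range := by
      refine Set.Finite.subset A.2 ?_
      rintro _ ⟨x, rfl⟩
      exact x.2
    have h5 : Nat.card ↥(A.1.comap φ.hom) ≠ 0 := by
      rw [← r.ker.card_mul_index, Subgroup.index_ker]
      exact mul_ne_zero Nat.card_pos.ne' Nat.card_pos.ne'
    exact (Nat.finite_of_card_ne_zero h5 : Finite ↥(A.1.comap φ.hom))⟩

/-- The surjection `φ^{-1}(A) → A` induced by `φ`. -/
def FinSub.hom (φ : Isog p n) (A : FinSub p n) : (A.comap φ).1 →* A.1 :=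
  φ.hom.subgroupComap A.1

theorem FinSub.hom_surjective (φ : Isog p n) (A : FinSub p n) :
    Function.Surjective (A.hom φ) :=
  MonoidHom.subgroupComap_surjective_of_surjective φ.hom A.1 φ.surjective

theorem FinSub.card_ker (φ : Isog p n) (A : FinSub p n) :
    ∃ j, Fintype.card (A.hom φ).ker = p ^ j := by
  have h : IsPGroup p (A.comap φ).1 := by
    intro χ
    obtain ⟨k, hk⟩ := exists_torsion χ.1
    exact ⟨k, Subtype.ext hk⟩
  obtain ⟨j, hj⟩ := IsPGroup.iff_card.1 (h.to_subgroup (A.hom φ).ker)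
  exact ⟨j, by rw [← hj, Nat.card_eq_fintype_card]⟩

/-- The inclusion of finite subgroups. -/
def FinSub.incl {A B : FinSub p n} (h : A ≤ B) : A.1 →* B.1 := Subgroup.inclusion h

theorem FinSub.incl_injective {A B : FinSub p n} (h : A ≤ B) : Function.Injective (FinSub.incl h) :=
  Subgroup.inclusion_injective h

variable {κ : Type u} [Field κ] [CharP κ p] {F : FormalGroup κ} {A B : FinSub p n} {R : TestRing.{u}}

/-- The quotient of an object `x` with level `φ^{-1}(A)` by the image of the kernel of `φ`. -/
def quot (φ : Isog p n) (A : FinSub p n) (x : LevelObj F (A.comap φ).1 R) : LevelObj F A.1 R :=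
  (exists_isQuot (A.hom_surjective φ) (A.card_ker φ) x).choose

theorem quot_spec (φ : Isog p n) (A : FinSub p n) (x : LevelObj F (A.comap φ).1 R) :
    IsQuot (A.hom φ) x (quot φ A x) :=
  (exists_isQuot (A.hom_surjective φ) (A.card_ker φ) x).choose_spec

theorem quot_eq {φ : Isog p n} {A : FinSub p n} {x : LevelObj F (A.comap φ).1 R}
    {y : LevelObj F A.1 R} (h : IsQuot (A.hom φ) x y) : quot φ A x = y :=
  (quot_spec φ A x).unique (A.hom_surjective φ) (A.card_ker φ) h

theorem quot_comp (φ ψ : Isog p n) (A : FinSub p n) (x : LevelObj F (A.comap (φ * ψ)).1 R) :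
    quot (φ * ψ) A x = quot φ A (quot ψ (A.comap φ) x) :=
  quot_eq ((quot_spec ψ (A.comap φ) x).comp ((A.comap φ).hom_surjective ψ)
    ((A.comap φ).card_ker ψ) (A.card_ker φ) (quot_spec φ A _))

theorem quot_one (A : FinSub p n) (x : LevelObj F (A.comap 1).1 R) : quot 1 A x = x :=
  quot_eq (IsQuot.refl (A := A.1) (fun _ => rfl) x)

theorem comap_mono (φ : Isog p n) (h : A ≤ B) : A.comap φ ≤ B.comap φ :=
  Subgroup.comap_mono (f := φ.hom) h

theorem quot_restrict (φ : Isog p n) (h : A ≤ B) (x : LevelObj F (B.comap φ).1 R) :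
    quot φ A (x.restrict (FinSub.incl (comap_mono φ h)) (FinSub.incl_injective _)) =
      (quot φ B x).restrict (FinSub.incl h) (FinSub.incl_injective h) := by
  refine quot_eq ?_
  refine IsQuot.restrict (φ' := B.hom φ) (FinSub.incl_injective (comap_mono φ h))
    (FinSub.incl_injective h) (fun a => rfl) (fun a' ha' => ?_) (quot_spec φ B x)
  refine ⟨⟨a'.1, ?_⟩, rfl⟩
  have h1 : φ.hom a'.1 = 1 := congrArg Subtype.val ha'
  show φ.hom a'.1 ∈ A.1
  rw [h1]; exact one_mem _

variable (F) in
/-- The ring of functions on the moduli problem of `A`-level structures on deformations of `F`: the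
`⋆`-invariant functions that are natural in the base ring. If the moduli problem is represented by a
complete local domain of characteristic zero, this is the representing ring, by Yoneda. -/
def LevelRing (A : FinSub p n) : Subring (∀ R : TestRing.{u}, LevelObj F A.1 R → R) where
  carrier := {f | (∀ R x y, IsStar x y → f R x = f R y) ∧
    ∀ (R S : TestRing.{u}) (g : R →+* S) [IsLocalHom g] (x : LevelObj F A.1 R)
      (y : LevelObj F A.1 S), IsPullback g x y → f S y = g (f R x)}
  zero_mem' := ⟨fun _ _ _ _ => rfl, fun _ _ g _ _ _ _ => (map_zero g).symm⟩
  one_mem' := ⟨fun _ _ _ _ => rfl, fun _ _ g _ _ _ _ => (map_one g).symm⟩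
  add_mem' hf hg := ⟨fun R x y h => congrArg₂ (· + ·) (hf.1 R x y h) (hg.1 R x y h),
    fun R S g _ x y h => (congrArg₂ (· + ·) (hf.2 R S g x y h) (hg.2 R S g x y h)).trans
      (map_add g _ _).symm⟩
  mul_mem' hf hg := ⟨fun R x y h => congrArg₂ (· * ·) (hf.1 R x y h) (hg.1 R x y h),
    fun R S g _ x y h => (congrArg₂ (· * ·) (hf.2 R S g x y h) (hg.2 R S g x y h)).trans
      (map_mul g _ _).symm⟩
  neg_mem' hf := ⟨fun R x y h => congrArg (- ·) (hf.1 R x y h),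
    fun R S g _ x y h => (congrArg (- ·) (hf.2 R S g x y h)).trans (map_neg g _).symm⟩

/-- Pullback of functions along restriction of level structures. -/
def res (h : A ≤ B) : LevelRing F A →+* LevelRing F B where
  toFun f := ⟨fun R x => f.1 R (x.restrict (FinSub.incl h) (FinSub.incl_injective h)),
    fun R x y hxy => f.2.1 R _ _ ⟨hxy.i, by
      obtain ⟨δ, h1, h2, h3⟩ := hxy.iso
      exact ⟨δ, h1, h2, fun a => h3 _⟩⟩,
    fun R S g _ x y hxy => f.2.2 R S g _ _ ⟨hxy.G, hxy.i, hxy.τ, fun a => hxy.l _⟩⟩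
  map_zero' := rfl
  map_one' := rfl
  map_add' _ _ := rfl
  map_mul' _ _ := rfl

/-- Pullback of functions along the quotient construction. -/
def quotPull (φ : Isog p n) (A : FinSub p n) : LevelRing F A →+* LevelRing F (A.comap φ) where
  toFun f := ⟨fun R x => f.1 R (quot φ A x),
    fun R x y hxy => f.2.1 R _ _
      (IsStar.quot (A.hom_surjective φ) (A.card_ker φ) hxy (quot_spec φ A x) (quot_spec φ A y)),
    fun R S g _ x y hxy => f.2.2 R S g _ _
      (IsPullback.quot (A.hom_surjective φ) (A.card_ker φ) hxy (quot_spec φ A x) (quot_spec φ A y))⟩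
  map_zero' := rfl
  map_one' := rfl
  map_add' _ _ := rfl
  map_mul' _ _ := rfl

variable (p n F)

/-- The colimit of the rings of `A`-level structures over the finite subgroups `A` of `T`. -/
def LevelColim : Type (u + 1) :=
  Ring.DirectLimit (fun A : FinSub p n => LevelRing F A) (fun _ _ h => res h)

instance : CommRing (LevelColim p n F) :=
  inferInstanceAs (CommRing (Ring.DirectLimit (fun A : FinSub p n => LevelRing F A)
    (fun _ _ h => res h)))

/-- The ring `C_0`. -/
def C0 : Type (u + 1) := TensorProduct ℤ ℚ (LevelColim p n F)

instance : CommRing (C0 p n F) := inferInstanceAs (CommRing (TensorProduct ℤ ℚ (LevelColim p n F)))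

variable {p n F}

/-- The canonical map to the colimit. -/
def LevelColim.of (A : FinSub p n) : LevelRing F A →+* LevelColim p n F :=
  Ring.DirectLimit.of (fun A : FinSub p n => LevelRing F A) (fun _ _ h => res h) A

theorem LevelColim.of_res (h : A ≤ B) (f : LevelRing F A) :
    LevelColim.of B (res h f) = LevelColim.of A f := 
  Ring.DirectLimit.of_f (G := fun A : FinSub p n => LevelRing F A) (f := fun _ _ h => res h) h f

theorem LevelColim.exists_of (c : LevelColim p n F) : ∃ A f, LevelColim.of A f = c :=
  Ring.DirectLimit.exists_of c

/-- The endomorphism of the colimit induced by an isogeny. -/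
def colimAct (φ : Isog p n) : LevelColim p n F →+* LevelColim p n F :=
  Ring.DirectLimit.lift (fun A : FinSub p n => LevelRing F A) (fun _ _ h => res h)
    (LevelColim p n F) (fun A => (LevelColim.of (A.comap φ)).comp (quotPull φ A)) (by
    intro A B h f
    have h1 : quotPull φ B (res h f) = res (comap_mono φ h) (quotPull φ A f) := by
      refine Subtype.ext ?_
      funext R x
      exact congrArg (f.1 R) (quot_restrict φ h x).symm
    rw [RingHom.comp_apply, RingHom.comp_apply, h1, LevelColim.of_res])

theorem colimAct_of (φ : Isog p n) (A : FinSub p n) (f : LevelRing F A) :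
    colimAct φ (LevelColim.of A f) = LevelColim.of (A.comap φ) (quotPull φ A f) :=
  Ring.DirectLimit.lift_of _ _ _ _ _

theorem colimAct_mul (φ ψ : Isog p n) (c : LevelColim p n F) :
    colimAct (φ * ψ) c = colimAct ψ (colimAct φ c) := by
  obtain ⟨A, f, rfl⟩ := c.exists_of
  rw [colimAct_of, colimAct_of, colimAct_of]
  have h1 : quotPull ψ (A.comap φ) (quotPull φ A f) = quotPull (φ * ψ) A f := by
    refine Subtype.ext ?_
    funext R x
    exact congrArg (f.1 R) (quot_comp φ ψ A x).symm
  exact congrArg (LevelColim.of (A.comap (φ * ψ))) h1.symm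

theorem colimAct_one (c : LevelColim p n F) : colimAct 1 c = c := by
  obtain ⟨A, f, rfl⟩ := c.exists_of
  rw [colimAct_of]
  have h1 : quotPull 1 A f = f := by
    refine Subtype.ext ?_
    funext R x
    exact congrArg (f.1 R) (quot_one A x)
  exact congrArg (LevelColim.of A) h1

/-- The element `q ⊗ c` of `C_0`. -/
def C0.tmul (q : ℚ) (c : LevelColim p n F) : C0 p n F := TensorProduct.tmul ℤ q c

theorem C0.ext_hom {f g : C0 p n F →+* C0 p n F}
    (h : ∀ (q : ℚ) (c : LevelColim p n F), f (C0.tmul q c) = g (C0.tmul q c)) : f = g := by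
  refine RingHom.ext fun c => ?_
  refine TensorProduct.induction_on c ?_ h ?_
  · exact (map_zero f).trans (map_zero g).symm
  · intro x y hx hy
    exact (map_add f x y).trans ((congrArg₂ (· + ·) hx hy).trans (map_add g x y).symm)

/-- The action of an isogeny on `C_0`. -/
def act (φ : Isog p n) : C0 p n F →+* C0 p n F :=
  (Algebra.TensorProduct.map (AlgHom.id ℤ ℚ) (colimAct φ).toIntAlgHom).toRingHom

theorem act_tmul (φ : Isog p n) (q : ℚ) (c : LevelColim p n F) :
    act φ (C0.tmul q c) = C0.tmul q (colimAct φ c) := rfl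

theorem act_mul (φ ψ : Isog p n) : (act (φ * ψ) : C0 p n F →+* C0 p n F) = (act ψ).comp (act φ) :=
  C0.ext_hom fun q c => by
    rw [RingHom.comp_apply, act_tmul, act_tmul, act_tmul, colimAct_mul]

theorem act_one : (act 1 : C0 p n F →+* C0 p n F) = RingHom.id _ :=
  C0.ext_hom fun q c => by rw [act_tmul, colimAct_one]; rfl

end Isogeny

section ClassFunctions
universe u v
variable (p : ℕ) [hp : Fact p.Prime] (n : ℕ) (G : Type v) [Group G]

/-- Continuous homomorphisms from `L = ℤ_p^n` to the discrete group `G`. -/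
structure LHom where
  hom : Lat p n →* G
  cont : @Continuous (Lat p n) G _ ⊥ hom

variable {p n G}

/-- The composite of `α : L → G` with `φ^* : L → L`. -/
def LHom.twist (α : LHom p n G) (φ : Isog p n) : LHom p n G where
  hom := α.hom.comp φ.dual
  cont := @Continuous.comp _ _ _ _ _ ⊥ φ.dual α.hom α.cont φ.continuous_dual

/-- The composite of `α : L → G` with a homomorphism `G → G'`. -/
def LHom.map {G' : Type*} [Group G'] (g : G →* G') (α : LHom p n G) : LHom p n G' where
  hom := g.comp α.hom
  cont := @Continuous.comp _ _ _ _ ⊥ ⊥ α.hom g continuous_bot α.cont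

variable (p n G)

/-- Conjugacy of homomorphisms. -/
instance conjSetoid : Setoid (LHom p n G) where
  r α β := ∃ g : G, ∀ v, β.hom v = g * α.hom v * g⁻¹
  iseqv :=
    { refl := fun α => ⟨1, fun v => by simp⟩
      symm := fun ⟨g, h⟩ => ⟨g⁻¹, fun v => by rw [h]; group⟩
      trans := fun ⟨g, h⟩ ⟨g', h'⟩ => ⟨g' * g, fun v => by rw [h', h]; group⟩ }

/-- The set `hom(L, G) / ∼` of conjugacy classes. -/
def ConjCl : Type v := Quotient (conjSetoid p n G)

/-- Generalized class functions with values in `C`. -/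
abbrev Cl (C : Type*) := ConjCl p n G → C

variable {p n G}

/-- The class of a homomorphism. -/
def LHom.cls (α : LHom p n G) : ConjCl p n G := Quotient.mk _ α

/-- The map `[α] ↦ [α φ^*]`. -/
def ConjCl.twist (c : ConjCl p n G) (φ : Isog p n) : ConjCl p n G :=
  Quotient.map (fun α => α.twist φ) (by
    rintro α β ⟨g, h⟩
    exact ⟨g, fun v => h (φ.dual v)⟩) c

variable {κ : Type u} [Field κ] [CharP κ p] {F : FormalGroup κ}

/-- The action of the automorphisms of `T` on class functions, `(f γ)([α]) = f([α γ^*]) γ`. -/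
def clAct (γ : MulAut (Tor p n)) (f : Cl p n G (C0 p n F)) : Cl p n G (C0 p n F) :=
  fun c => act (Isog.ofAut γ) (f (c.twist (Isog.ofAut γ)))

/-- Invariance under the automorphisms of `T`. -/
def IsInvariant (f : Cl p n G (C0 p n F)) : Prop := ∀ γ : MulAut (Tor p n), clAct γ f = f

variable (p n)

/-- A section of the map `φ ↦ ker φ` from isogenies to finite subgroups of `T`. -/
structure KerSection where
  toFun : FinSub p n → Isog p n
  ker_toFun : ∀ H, (toFun H).ker = H

variable {p n} {m : ℕ}

/-- The annihilator in `T` of the stabilizer in `L` of `i`, that is `(L / L_i)^*`. -/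
def stabAnn (β : LHom p n (Equiv.Perm (Fin m))) (i : Fin m) : FinSub p n :=
  ⟨{ carrier := {χ | ∀ v, β.hom v i = i → χ v = 1}
     one_mem' := fun _ _ => rfl
     mul_mem' := fun {χ ψ} hχ hψ v hv => by
       have h1 : χ v * ψ v = 1 := by rw [hχ v hv, hψ v hv, one_mul]
       exact h1
     inv_mem' := fun {χ} hχ v hv => by
       have h1 : (χ v)⁻¹ = 1 := by rw [hχ v hv, inv_one]
       exact h1 }, by
    refine (finite_torsion (Nat.card (Equiv.Perm (Fin m)))).subset fun χ hχ => ?_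
    obtain ⟨k, hk⟩ := exists_torsion χ
    have h1 : χ ^ Nat.card (Equiv.Perm (Fin m)) = 1 := by
      apply PontryaginDual.ext
      intro v
      rw [pd_pow, ← map_pow]
      refine hχ _ ?_
      rw [map_pow, pow_card_eq_one']; rfl
    obtain ⟨j, -, hj⟩ := (Nat.dvd_prime_pow hp.out).1 (orderOf_dvd_of_pow_eq_one hk)
    have h2 : p ^ j ≤ Nat.card (Equiv.Perm (Fin m)) :=
      Nat.le_of_dvd Nat.card_pos (hj ▸ orderOf_dvd_of_pow_eq_one h1)
    have h3 : j ≤ Nat.card (Equiv.Perm (Fin m)) := (Nat.lt_pow_self hp.out.one_lt).le.trans h2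
    exact orderOf_dvd_iff_pow_eq_one.1 (hj ▸ pow_dvd_pow p h3)⟩

theorem mem_stabAnn {β : LHom p n (Equiv.Perm (Fin m))} {i : Fin m} {χ : Tor p n} :
    χ ∈ (stabAnn β i).1 ↔ ∀ v, β.hom v i = i → χ v = 1 := Iff.rfl

theorem perm_inv_self (s : Equiv.Perm (Fin m)) (i : Fin m) : s⁻¹ (s i) = i := s.symm_apply_apply i

/-- Two points are equivalent if they lie in the same orbit of `L`. -/
def orbSetoid (β : LHom p n (Equiv.Perm (Fin m))) : Setoid (Fin m) where
  r i j := ∃ v, β.hom v i = j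
  iseqv :=
    { refl := fun i => ⟨1, by rw [map_one]; rfl⟩
      symm := fun {i j} ⟨v, h⟩ => ⟨v⁻¹, by rw [map_inv, ← h, perm_inv_self]⟩
      trans := fun {i j k} ⟨v, h⟩ ⟨w, h'⟩ => ⟨w * v, by
        rw [map_mul, Equiv.Perm.mul_apply, h, h']⟩ }

/-- The set of orbits of `L` on `{1, …, m}`. -/
def Orb (β : LHom p n (Equiv.Perm (Fin m))) : Type := Quotient (orbSetoid β)

instance (β : LHom p n (Equiv.Perm (Fin m))) : Finite (Orb β) :=
  inferInstanceAs (Finite (Quotient (orbSetoid β)))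

instance (β : LHom p n (Equiv.Perm (Fin m))) : Fintype (Orb β) := Fintype.ofFinite _

/-- The finite subgroup `H_o = (L / L_o)^*` of `T` that belongs to an orbit `o`. -/
def orbSub (β : LHom p n (Equiv.Perm (Fin m))) : Orb β → FinSub p n :=
  Quotient.lift (stabAnn β) (by
    rintro i _ ⟨v, rfl⟩
    have h : ∀ w, β.hom w (β.hom v i) = β.hom v i ↔ β.hom w i = i := fun w => by
      rw [← Equiv.Perm.mul_apply, ← map_mul, mul_comm, map_mul, Equiv.Perm.mul_apply,
        EmbeddingLike.apply_eq_iff_eq]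
    refine Subtype.ext (Subgroup.ext fun χ => ?_)
    rw [mem_stabAnn, mem_stabAnn]
    exact forall_congr' fun w => by rw [h])

/-- Conjugate actions have the same orbits. -/
def orbEquiv {β β' : LHom p n (Equiv.Perm (Fin m))} (s : Equiv.Perm (Fin m))
    (h : ∀ v, β'.hom v = s * β.hom v * s⁻¹) : Orb β ≃ Orb β' :=
  Quotient.congr s fun i j => by
    refine exists_congr fun v => ?_
    rw [h, Equiv.Perm.mul_apply, Equiv.Perm.mul_apply, perm_inv_self,
      EmbeddingLike.apply_eq_iff_eq]

theorem orbSub_orbEquiv {β β' : LHom p n (Equiv.Perm (Fin m))} (s : Equiv.Perm (Fin m))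
    (h : ∀ v, β'.hom v = s * β.hom v * s⁻¹) (o : Orb β) :
    orbSub β' (orbEquiv s h o) = orbSub β o := by
  obtain ⟨i, rfl⟩ := Quotient.exists_rep o
  refine Subtype.ext (Subgroup.ext fun χ => ?_)
  refine (mem_stabAnn (β := β') (i := s i)).trans (Iff.trans ?_ (mem_stabAnn (β := β) (i := i)).symm)
  refine forall_congr' fun v => ?_
  rw [h, Equiv.Perm.mul_apply, Equiv.Perm.mul_apply, perm_inv_self,
      EmbeddingLike.apply_eq_iff_eq]

/-- The power operation `P_m^φ` on class functions,
`P_m^φ(f)([α], ⊕ H_i) = ∏_i f([α φ_{H_i}^*]) φ_{H_i}`, where a homomorphism `L → G × Σ_m` has the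
components `α` and `β`, and the `H_i` are the subgroups of `T` that belong to the orbits of `β`. -/
def powerOp (φ : KerSection p n) (m : ℕ) (f : Cl p n G (C0 p n F)) :
    Cl p n (G × Equiv.Perm (Fin m)) (C0 p n F) :=
  Quotient.lift (fun h : LHom p n (G × Equiv.Perm (Fin m)) =>
    ∏ o : Orb (h.map (MonoidHom.snd _ _)),
      act (φ.toFun (orbSub (h.map (MonoidHom.snd _ _)) o))
        (f ((h.map (MonoidHom.fst _ _)).cls.twist (φ.toFun (orbSub (h.map (MonoidHom.snd _ _)) o)))))
    (by
      rintro h h' ⟨g, hg⟩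
      have h1 : (h'.map (MonoidHom.fst G (Equiv.Perm (Fin m)))).cls =
          (h.map (MonoidHom.fst G (Equiv.Perm (Fin m)))).cls :=
        Quotient.sound ⟨g.1⁻¹, fun v => by
          show (h.hom v).1 = g.1⁻¹ * (h'.hom v).1 * g.1⁻¹⁻¹
          rw [hg]; simp [mul_assoc]⟩
      have h2 : ∀ v, (h'.map (MonoidHom.snd G (Equiv.Perm (Fin m)))).hom v =
          g.2 * (h.map (MonoidHom.snd G (Equiv.Perm (Fin m)))).hom v * g.2⁻¹ := fun v => by
        show (h'.hom v).2 = g.2 * (h.hom v).2 * g.2⁻¹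
        rw [hg]; rfl
      refine Fintype.prod_equiv (orbEquiv g.2 h2) _ _ fun o => ?_
      rw [orbSub_orbEquiv, h1])

end ClassFunctions

section Height
universe u
variable {κ : Type u} [Field κ]

/-- The power series `[k](X)` of a formal group. -/
def mulSeries (F : FormalGroup κ) : ℕ → PowerSeries κ
  | 0 => 0
  | k + 1 => F.toPowerSeries.subst ![(PowerSeries.X : PowerSeries κ), mulSeries F k]

/-- A formal group over a field of characteristic `p` has height `n` if `[p](X)` has order `p ^ n`. -/
def HasHeight (F : FormalGroup κ) (p n : ℕ) : Prop := (mulSeries F p).order = ((p ^ n : ℕ) : ℕ∞)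

end Height

end LubinTate
end

noncomputable section
namespace LubinTate

/-! ### Duality between lattice and torsion group; isogenies with a common kernel -/

section Duality
variable {p : ℕ} [hp : Fact p.Prime] {n : ℕ}

/-! For an isogeny $\varphi$ of $\mathbb{T}$ and a class function $f$, write $f\cdot\varphi$ for the
function $[\alpha]\mapsto f([\alpha\varphi^*])\,\varphi$. The assignments $\varphi\mapsto\varphi^*$
and $\varphi\mapsto(\text{action on }C_0)$ both reverse composition: this is `Isog.dual_mul` on the
lattice side and `act_mul` on the coefficient side. Hence
$f\cdot(\varphi\psi)=(f\cdot\varphi)\cdot\psi$, so the whole monoid of isogenies acts on class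
functions from the right, and this action extends that of $\mathrm{Aut}(\mathbb{T})$. In this
notation $P_m^\phi(f)([(\alpha,\beta)])=\prod_o (f\cdot\phi_{H_o})([\alpha])$.

The central point is that, for invariant $f$, the function $f\cdot\varphi$ depends only on
$\ker\varphi$ (`IsInvariant.act_twist`). Isogenies are surjective, because $\mathbb{T}$ is divisible
and torsion with finite $p^k$-torsion. Two isogenies $\varphi,\xi$ with the same kernel therefore
identify $\mathbb{T}$ with the same quotient of $\mathbb{T}$, so $\varphi=\gamma\xi$ for an
automorphism $\gamma$ (`Isog.exists_ofAut_mul`). Then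
$f\cdot\varphi=(f\cdot\gamma)\cdot\xi=f\cdot\xi$.

Independence of the section follows factor by factor: $\phi_{H_o}$ and $\xi_{H_o}$ both have kernel
$H_o$.

Invariance of $P_m^\phi(f)$ uses the same principle a second time. Acting by $\gamma$ replaces
$(\alpha,\beta)$ by $(\alpha\gamma^*,\beta\gamma^*)$. Since $\gamma^*$ is onto, the orbits of
$\mathbb{L}$ on $\{1,\dots,m\}$ are unchanged as sets, while the subgroup $H'_o$ attached to an
orbit for $\beta\gamma^*$ satisfies $\gamma^{-1}(H'_o)=H_o$ (`orbSub_twist`). The factor at $o$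
becomes $(f\cdot(\phi_{H'_o}\gamma))([\alpha])$, and $\phi_{H'_o}\gamma$ has kernel
$\gamma^{-1}(H'_o)=H_o$. In general this isogeny is not $\phi_{H_o}$, but it has the same kernel,
and for invariant $f$ that suffices. No equivariance of the section is needed.

About $C_0$ the argument uses only that isogenies act on it from the right by ring maps. The
arithmetic input, namely quotients of formal groups by finite groups of points and the compatibility
of iterated quotients, enters through the construction of that action. -/

/-- The characters separate the points of the lattice. -/
theorem lat_ext {v w : Lat p n} (h : ∀ χ : Tor p n, χ v = χ w) : v = w := by
  refine Multiplicative.toAdd.injective (funext fun i => PadicInt.ext_of_toZModPow.1 fun k => ?_)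
  -- The character attached to the $i$-th basis vector at level $k$ is $v\mapsto\exp(2\pi
  -- i\,v_i/p^k)$ (with $v_i$ the $i$-th coordinate), so it detects exactly $v_i$ modulo $p^k$.
  -- Letting $k$ vary determines the $p$-adic integer $v_i$.
  have h1 := h (chr k (Pi.single i 1))
  rw [chr_apply, chr_apply, rt_eq_iff, ← PadicInt.ker_toZModPow, RingHom.mem_ker, map_sub,
    sub_eq_zero] at h1
  simpa [Pi.single_apply] using h1

theorem Isog.hom_mul (φ ψ : Isog p n) (χ : Tor p n) : (φ * ψ).hom χ = φ.hom (ψ.hom χ) := rfl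

/-- The dual is obtained by choice from an existence statement, so functoriality is not
definitional. It follows from uniqueness: every character $\chi$ takes the value
$(\varphi(\psi\chi))(v)$ on both sides, and characters separate the points of the lattice. The order
of the factors reverses, which makes twisting class functions a right action. -/
theorem Isog.dual_mul (φ ψ : Isog p n) (v : Lat p n) :
    (φ * ψ).dual v = ψ.dual (φ.dual v) :=
  lat_ext fun χ => by rw [dual_spec, dual_spec, dual_spec, hom_mul]

theorem Isog.dual_one (v : Lat p n) : (1 : Isog p n).dual v = v :=
  lat_ext fun χ => dual_spec 1 χ v

theorem Isog.ofAut_inv_mul (γ : MulAut (Tor p n)) : ofAut γ⁻¹ * ofAut γ = 1 :=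
  Subtype.ext (MonoidHom.ext fun χ => γ.symm_apply_apply χ)

/-- Surjectivity of $\gamma^*$ is what lets a quantifier over $v\in\mathbb{L}$ be replaced by one
over $\gamma^*v$. Orbits and stabilizers of a twisted action are compared with those of the original
one in this way. -/
theorem Isog.dual_ofAut_surjective (γ : MulAut (Tor p n)) :
    Function.Surjective (ofAut γ).dual := fun v =>
  -- Duality reverses products, so $\gamma^*\circ(\gamma^{-1})^*$ is the dual of
  -- $\gamma^{-1}\gamma=1$. This is why the identity with the inverse on the left is the one
  -- required.
  ⟨(ofAut γ⁻¹).dual v, by rw [← dual_mul, ofAut_inv_mul, dual_one]⟩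

/-- Two isogenies with the same kernel differ by an automorphism. -/
theorem Isog.exists_ofAut_mul {φ ξ : Isog p n} (h : φ.ker = ξ.ker) :
    ∃ γ : MulAut (Tor p n), φ = ofAut γ * ξ := by
  have hk : ξ.hom.ker = φ.hom.ker := congrArg Subtype.val h.symm
  -- The automorphism is the composite
  -- $\mathbb{T}\cong\mathbb{T}/\ker\xi=\mathbb{T}/\ker\varphi\cong\mathbb{T}$. The two outer
  -- isomorphisms are the first isomorphism theorem for $\xi$ and $\varphi$, which applies with
  -- target all of $\mathbb{T}$ because a finite kernel forces surjectivity.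
  refine ⟨(QuotientGroup.quotientKerEquivOfSurjective ξ.hom ξ.surjective).symm.trans
    ((QuotientGroup.quotientMulEquivOfEq hk).trans
      (QuotientGroup.quotientKerEquivOfSurjective φ.hom φ.surjective)), ?_⟩
  refine Subtype.ext (MonoidHom.ext fun χ => ?_)
  -- The inverse isomorphism does not compute on a general element of $\mathbb{T}$. On a point of
  -- the form $\xi(\chi)$ it must give the class of $\chi$, since the forward map sends that class
  -- to $\xi(\chi)$.
  have h1 : (QuotientGroup.quotientKerEquivOfSurjective ξ.hom ξ.surjective).symm (ξ.hom χ) =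
      (χ : Tor p n ⧸ ξ.hom.ker) := by
    rw [MulEquiv.symm_apply_eq]; rfl
  -- Once $\xi(\chi)$ has become the class of $\chi$, the rest of the composite computes: the class
  -- of $\chi$ modulo $\ker\varphi$ is sent to $\varphi(\chi)$.
  refine Eq.symm (Eq.trans (congrArg (fun x => QuotientGroup.quotientKerEquivOfSurjective φ.hom
    φ.surjective (QuotientGroup.quotientMulEquivOfEq hk x)) h1) ?_)
  rfl

end Duality

/-! ### Isogenies acting on invariant class functions, and the power operation -/

section Invariance
universe u v
variable {p : ℕ} [hp : Fact p.Prime] {n : ℕ} {G : Type v} [Group G]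
variable {κ : Type u} [Field κ] [CharP κ p] {F : FormalGroup κ}

/-- This is $\alpha\circ(\varphi\psi)^*=(\alpha\circ\psi^*)\circ\varphi^*$, read on conjugacy
classes. Combined with `act_mul`, it shows that $(f\cdot\varphi)\cdot\psi=f\cdot(\varphi\psi)$,
where $f\cdot\varphi$ is the function $[\alpha]\mapsto f([\alpha\varphi^*])\,\varphi$. -/
theorem ConjCl.twist_mul (c : ConjCl p n G) (φ ψ : Isog p n) :
    c.twist (φ * ψ) = (c.twist ψ).twist φ := by
  obtain ⟨α, rfl⟩ := Quotient.exists_rep c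
  -- The two representing homomorphisms agree pointwise, so the conjugating element can be taken to
  -- be the identity of $G$.
  refine Quotient.sound ⟨1, fun v => ?_⟩
  show α.hom (ψ.dual (φ.dual v)) = 1 * α.hom ((φ * ψ).dual v) * 1⁻¹
  rw [Isog.dual_mul, one_mul, inv_one, mul_one]

/-- For an invariant `f`, the value `f([α φ^*]) φ` depends only on the kernel of `φ`. -/
theorem IsInvariant.act_twist {f : Cl p n G (C0 p n F)} (hf : IsInvariant f) {φ ξ : Isog p n}
    (h : φ.ker = ξ.ker) (c : ConjCl p n G) :
    act φ (f (c.twist φ)) = act ξ (f (c.twist ξ)) := by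
  -- Equality of kernels is used only here: it allows $\varphi$ to be replaced by $\gamma\xi$.
  obtain ⟨γ, rfl⟩ := Isog.exists_ofAut_mul h
  rw [act_mul, RingHom.comp_apply, ConjCl.twist_mul]
  -- After both twists are split, $\xi$ is the outer ring map on $C_0$, and its argument is
  -- precisely the value of $f\cdot\gamma$ at $[\alpha\xi^*]$. Invariance of $f$ removes $\gamma$
  -- there. Having $\gamma$ on the left of $\xi$ is essential, since it is then applied to $f$
  -- first.
  exact congrArg (act ξ) (congrFun (hf γ) (c.twist ξ))

/-- The orbits $o$ and the subgroups $H_o$ depend on $\beta$ alone, so the two products run over the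
same index set. Corresponding factors use isogenies with the same kernel $H_o$, and such factors
agree for invariant $f$. -/
theorem IsInvariant.powerOp_eq {f : Cl p n G (C0 p n F)} (hf : IsInvariant f)
    (φ ξ : KerSection p n) (m : ℕ) : powerOp φ m f = powerOp ξ m f := by
  funext c
  obtain ⟨h, rfl⟩ := Quotient.exists_rep c
  exact Finset.prod_congr rfl fun o _ =>
    hf.act_twist ((φ.ker_toFun _).trans (ξ.ker_toFun _).symm) _

variable {m : ℕ}

/-- Twisting an action of the lattice by an automorphism does not change the orbits. -/
def orbTwistEquiv (β : LHom p n (Equiv.Perm (Fin m))) (γ : MulAut (Tor p n)) :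
    Orb (β.twist (Isog.ofAut γ)) ≃ Orb β :=
  Quotient.congr (Equiv.refl _) fun i j =>
    -- The underlying bijection of $\{1,\dots,m\}$ is the identity. Two points lie in one orbit of
    -- $\beta\gamma^*$ when some $\beta(\gamma^*v)$ moves one to the other, and the elements
    -- $\gamma^*v$ exhaust the lattice.
    ((Isog.dual_ofAut_surjective γ).exists (p := fun v => β.hom v i = j)).symm

/-- The stabilizer of a point under $\beta\gamma^*$ is the inverse image under $\gamma^*$ of its
stabilizer $\mathbb{L}_o$ under $\beta$. By the adjunction $(\gamma\chi)(v)=\chi(\gamma^*v)$, the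
character $\gamma\chi$ kills that inverse image exactly when $\chi$ kills $\mathbb{L}_o$. The form
with an inverse image under $\gamma$ matches the kernel of a composite isogeny whose right-hand
factor is $\gamma$. -/
theorem orbSub_twist (β : LHom p n (Equiv.Perm (Fin m))) (γ : MulAut (Tor p n))
    (o : Orb (β.twist (Isog.ofAut γ))) :
    (orbSub (β.twist (Isog.ofAut γ)) o).comap (Isog.ofAut γ) = orbSub β (orbTwistEquiv β γ o) := by
  obtain ⟨i, rfl⟩ := Quotient.exists_rep o
  refine Subtype.ext (Subgroup.ext fun χ => ?_)
  -- The middle statement is membership in $H_o$ written out at the representative $i$. The right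
  -- half is definitional because the comparison of orbits is the identity on representatives.
  refine Iff.trans (b := ∀ v, β.hom v i = i → χ v = 1) ?_ Iff.rfl
  -- The substitution $v=\gamma^*w$ turns the condition on the stabilizer for $\beta$ into one
  -- indexed by the same $w$ as the condition for $\beta\gamma^*$. The hypotheses then coincide, and
  -- duality identifies the conclusions.
  rw [(Isog.dual_ofAut_surjective γ).forall]
  refine forall_congr' fun v => ?_
  rw [Isog.dual_spec]
  rfl

/-- The right-hand factor is applied first, so it is the one along which the kernel is pulled back.
For $\phi_{H'}\gamma$ with $\gamma$ an automorphism this gives $\gamma^{-1}(H')$. -/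
theorem Isog.ker_mul (φ ψ : Isog p n) : (φ * ψ).ker = φ.ker.comap ψ :=
  Subtype.ext (Subgroup.ext fun _ => Iff.rfl)

/-- A section need not satisfy $\phi_{H'}\gamma=\phi_{\gamma^{-1}H'}$, so the factors are not
matched by an identity between isogenies. They are matched because these two isogenies have the same
kernel, and $f$ is invariant. -/
theorem IsInvariant.powerOp {f : Cl p n G (C0 p n F)} (hf : IsInvariant f)
    (φ : KerSection p n) (m : ℕ) : IsInvariant (powerOp φ m f) := by
  intro γ
  funext c
  obtain ⟨h, rfl⟩ := Quotient.exists_rep c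
  let β := h.map (MonoidHom.snd G (Equiv.Perm (Fin m)))
  let α := h.map (MonoidHom.fst G (Equiv.Perm (Fin m)))
  let g := Isog.ofAut γ
  -- Comparison of single factors. On the left is the factor of $P_m^\phi(f)$ at
  -- $(\alpha\gamma^*,\beta\gamma^*)$ for an orbit $o$, moved by $\gamma$. On the right is the
  -- factor at $(\alpha,\beta)$ for the corresponding orbit of $\beta$.
  have key : ∀ o : Orb (β.twist g),
      act g (act (φ.toFun (orbSub (β.twist g) o))
        (f ((α.cls.twist g).twist (φ.toFun (orbSub (β.twist g) o))))) =
      act (φ.toFun (orbSub β (orbTwistEquiv β γ o)))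
        (f (α.cls.twist (φ.toFun (orbSub β (orbTwistEquiv β γ o))))) := by
    intro o
    -- The twists of $\alpha$ by $\gamma$ and by $\phi_{H'_o}$, together with the two ring maps on
    -- $C_0$, combine into those of the single isogeny $\phi_{H'_o}\gamma$, where $H'_o$ is the
    -- subgroup of the twisted action.
    rw [← ConjCl.twist_mul, ← RingHom.comp_apply, ← act_mul]
    refine hf.act_twist ?_ _
    -- Only the section property is needed about $\phi$:
    -- $\ker(\phi_{H'_o}\gamma)=\gamma^{-1}(\ker\phi_{H'_o})=\gamma^{-1}(H'_o)=H_o=\ker\phi_{H_o}$.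
    rw [Isog.ker_mul, φ.ker_toFun, φ.ker_toFun, orbSub_twist]
  -- The automorphism passes through the product because it acts on $C_0$ by a ring map. Twisting
  -- $(\alpha,\beta)$ twists each component by $\gamma^*$ definitionally, so the product is indexed
  -- by the orbits of $\beta\gamma^*$ and can be reindexed by those of $\beta$.
  exact (map_prod (act g) _ _).trans (Fintype.prod_equiv (orbTwistEquiv β γ) _ _ key)

end Invariance

end LubinTate
end

/-! ### The theorem on invariants and independence of the section -/

theorem mainTheorem2 (p : ℕ) [Fact p.Prime] (n : ℕ) (κ : Type*) [Field κ] [CharP κ p]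
    [PerfectField κ] (F : FormalGroup κ) [F.IsComm] (hF : LubinTate.HasHeight F p n)
    (G : Type*) [Group G] [Finite G] (m : ℕ) :
    (∀ (φ : LubinTate.KerSection p n) (f : LubinTate.Cl p n G (LubinTate.C0 p n F)),
      LubinTate.IsInvariant f → LubinTate.IsInvariant (LubinTate.powerOp φ m f)) ∧
    ∀ (φ ξ : LubinTate.KerSection p n) (f : LubinTate.Cl p n G (LubinTate.C0 p n F)),
      LubinTate.IsInvariant f → LubinTate.powerOp φ m f = LubinTate.powerOp ξ m f :=
  ⟨fun φ _ hf => hf.powerOp φ m, fun φ ξ _ hf => hf.powerOp_eq φ ξ m⟩
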